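/- Let $V$ be a finite set and let $\binom{V}{2}$ be the set of unordered pairs of distinct elements of $V$. For a graph $G$ on $V$ let $d_G(x,y)\in\{0,1,2,\dots\}\cup\{\infty\}$ be the graph distance. A set $\mathcal Q\subseteq\binom{V}{2}$ reconstructs a connected graph $G$ on $V$ if every graph $G'$ on $V$ with $d_{G'}(x,y)=d_G(x,y)$ for all $\{x,y\}\in\mathcal Q$ equals $G$. An adaptive algorithm queries pairs of distinct vertices of a hidden graph $G$ one after another; the answer to the query $\{x,y\}$ is $d_G(x,y)$, and the next query (or the decision to halt) depends on the answers to all the earlier queries. For $q\in\mathbb N$, a graph $G$ is $q$-reconstructible by the adaptive algorithm $\mathtt A$ if $G$ is connected and $\mathtt A$, run on $G$, makes at most $q$ queries and the set of queried pairs reconstructs $G$. Let $G(n,p)$ be the binomial random graph on $n$ vertices, in which each pair is an edge independently with probability $p$. **Theorem.** Let $k\ge 1$ be an integer and let $\varepsilon>0$. Then there is a constant $C=C(k,\varepsilon)>0$ such that the following holds. Let $p=p(n)\in[0,1]$ be such that, for all sufficiently large $n$, $$n^{-1+\varepsilon}<p<n^{-k/(k+1)-\varepsilon}.$$ Then there is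 an adaptive algorithm $\mathtt A$ (which may depend on $n$ and $p$) such that, for $$q=\left\lfloor\frac{C}{n^{k-2}p^{k}}\right\rfloor,$$ the probability that $G_n\sim G(n,p)$ is $q$-reconstructible by $\mathtt A$ tends to $1$ as $n\to\infty$. -/

import Mathlib

/-- An adaptive algorithm on the vertex set `V` with access to a distance oracle, as a decision
tree: it either halts, or queries a pair of distinct vertices and continues in a way that depends
on the answer of the oracle, and hence on all the answers received so far. An answer is an element
of `ℕ∞`: a natural number, or `⊤` if the two vertices lie in different components. -/
inductive QueryAlgorithm (V : Type*) : Type _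
  | halt : QueryAlgorithm V
  | query (x y : V) (hxy : x ≠ y) (next : ℕ∞ → QueryAlgorithm V) : QueryAlgorithm V

/-- The list of the pairs that the algorithm queries, in order, if the hidden graph is `G`. -/
noncomputable def QueryAlgorithm.queries {V : Type*} (G : SimpleGraph V) :
    QueryAlgorithm V → List (Sym2 V)
  | .halt => []
  | .query x y _ next => s(x, y) :: (next (G.edist x y)).queries G

/-- The set `Q` of pairs reconstructs the connected graph `G`: no other graph on the same vertex
set, connected or not, has the same distances between the pairs in `Q`. -/
def Reconstructs {V : Type*} (Q : Set (Sym2 V)) (G : SimpleGraph V) : Prop :=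
  G.Connected ∧
    ∀ G' : SimpleGraph V, (∀ x y : V, s(x, y) ∈ Q → G'.edist x y = G.edist x y) → G' = G

/-- The graph `G` is `q`-reconstructible by the algorithm `A`: run on the hidden graph `G`, the
algorithm makes at most `q` queries, and the set of queried pairs reconstructs `G`. -/
def IsReconstructibleBy {V : Type*} (A : QueryAlgorithm V) (q : ℕ) (G : SimpleGraph V) : Prop :=
  (A.queries G).length ≤ q ∧ Reconstructs {e | e ∈ A.queries G} G

/-!
# Reconstructing a sparse random graph from distance queries

Write `d = n p` for the expected degree. The hypothesis says that `d` is at least `n ^ ε` and that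
`d ^ (k + 1)` is smaller than `n` by a power of `n`.

*The algorithm.* Fix a long list `l` of vertices, the seeds. Each vertex `v` is compared with the
seeds in order until `t` of them have been found within distance `k` of `v`, where `t` depends on
`ε` only. A ball of radius `k` has size of order `d ^ k`, so for random seeds this takes about
`t n / d ^ k` queries for each vertex, and `t n ^ 2 / d ^ k` in total, which is the order of the
allowed number. If a seed `s` has distance at most `k` from `v` and at least `k + 2` from `u`, then
`u` and `v` are not adjacent, and whichever of `u` and `v` stops first, the seeds read for it have
been read for the other one too. All the pairs not separated in this way are queried directly, so
the queried pairs always reconstruct a connected graph (`isReconstructibleBy_seedAlgorithm`).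

*The seeds.* For non-adjacent `u` and `v`, only a fraction `ρ = n ^ (-ε / 4)` of the ball of radius
`k` around `v` lies within distance `k + 1` of `u`, so the `t` seeds found for `v` fail to separate
`u` from `v` with probability `ρ ^ t ≤ n ^ (-3)` (`seedExp_firstHitsIn_le`). Hence only the edges,
about `n d ≤ n ^ 2 / d ^ k` pairs, are left for direct queries. The total time of the scans is
concentrated by an exponential supermartingale (`seedExp_exp_sum_stopTime_le`): since no seed hits
more than a constant times the average number of vertices, a constant factor `C`, without a
logarithm, suffices with probability tending to one. Averaging over the seeds then gives a fixed
list that works for almost all graphs (`exists_graphExp_le_of_seedExp_le`).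

*The random graph.* With high probability the graph is connected, its degrees are at most `4 d`,
and sets of size at most `1 / p` expand by the factor `d / 16`, so that the balls of radius `k` have
sizes between `(d / 16) ^ k` and `(5 d) ^ k`. The intersection of the balls around two non-adjacent
vertices `v` and `u` is, up to a ball of radius `k - 1`, a sum over the neighbours `x` of `v` of
overlaps of balls in the graph without `v` (`closedBall_inter_subset`). The neighbourhood of `v` is
independent of that graph, so a Chernoff bound applies (`graphProb_star_sum_le`).
-/

namespace DistanceReconstruction

open Finset

/-! ### Random subsets -/

section Bernoulli

/-- The expectation of `f S`, where `S` is a random subset of `u` that contains each element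
independently with probability `p`. -/
noncomputable def bernoulliExp {ι : Type*} [DecidableEq ι] (p : ℝ) (u : Finset ι)
    (f : Finset ι → ℝ) : ℝ :=
  ∑ S ∈ u.powerset, p ^ #S * (1 - p) ^ #(u \ S) * f S

variable {ι κ : Type*} [DecidableEq ι] [DecidableEq κ] {p : ℝ} {u : Finset ι}

lemma bernoulliExp_prod (p : ℝ) (u : Finset ι) (x y : ι → ℝ) :
    bernoulliExp p u (fun S => (∏ e ∈ S, x e) * ∏ e ∈ u \ S, y e) =
      ∏ e ∈ u, (p * x e + (1 - p) * y e) := by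
  rw [prod_add, bernoulliExp]
  refine sum_congr rfl fun S _ => ?_
  simp only [prod_mul_distrib, prod_const]
  ring

lemma bernoulliExp_mono (hp0 : 0 ≤ p) (hp1 : p ≤ 1) {f g : Finset ι → ℝ}
    (h : ∀ S ⊆ u, f S ≤ g S) : bernoulliExp p u f ≤ bernoulliExp p u g := by
  refine sum_le_sum fun S hS => ?_
  have : 0 ≤ 1 - p := by linarith
  exact mul_le_mul_of_nonneg_left (h S (mem_powerset.1 hS)) (by positivity)

lemma bernoulliExp_congr {f g : Finset ι → ℝ}
    (h : ∀ S ⊆ u, f S = g S) : bernoulliExp p u f = bernoulliExp p u g :=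
  sum_congr rfl fun S hS => by rw [h S (mem_powerset.1 hS)]

lemma bernoulliExp_sum {β : Type*} (s : Finset β) (f : β → Finset ι → ℝ) :
    bernoulliExp p u (fun S => ∑ b ∈ s, f b S) = ∑ b ∈ s, bernoulliExp p u (f b) := by
  simp only [bernoulliExp, mul_sum]
  exact sum_comm

lemma bernoulliExp_const_mul (c : ℝ) (f : Finset ι → ℝ) :
    bernoulliExp p u (fun S => c * f S) = c * bernoulliExp p u f := by
  simp only [bernoulliExp, mul_sum]
  exact sum_congr rfl fun _ _ => by ring

lemma bernoulliExp_const (c : ℝ) : bernoulliExp p u (fun _ => c) = c := by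
  have h := bernoulliExp_prod p u (fun _ => 1) (fun _ => 1)
  simp only [prod_const_one, mul_one, add_sub_cancel] at h
  have h' := bernoulliExp_const_mul (p := p) (u := u) c (fun _ => 1)
  simpa [h] using h'

lemma bernoulliExp_union {w : Finset ι} (h : Disjoint u w) (f : Finset ι → ℝ) :
    bernoulliExp p (u ∪ w) f =
      bernoulliExp p u (fun S => bernoulliExp p w (fun T => f (S ∪ T))) := by
  simp only [bernoulliExp, mul_sum]
  rw [← sum_product']
  symm
  refine sum_nbij' (fun x => x.1 ∪ x.2) (fun R => (R ∩ u, R ∩ w)) ?_ ?_ ?_ ?_ ?_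
  · simp only [mem_product, mem_powerset]
    exact fun x hx => union_subset_union hx.1 hx.2
  · simp
  · simp only [mem_product, mem_powerset, Prod.forall, Prod.mk.injEq]
    intro S T hx
    have := Finset.disjoint_left.1 h
    constructor
    · ext e; simp only [mem_inter, mem_union]; have := @hx.1 e; have := @hx.2 e; tauto
    · ext e; simp only [mem_inter, mem_union]; have := @hx.1 e; have := @hx.2 e; tauto
  · intro R hR
    rw [← inter_union_distrib_left, inter_eq_left.2 (mem_powerset.1 hR)]
  · rintro ⟨S, T⟩ hx
    simp only [mem_product, mem_powerset] at hx
    have hST : Disjoint S T := h.mono hx.1 hx.2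
    have h2 : (u ∪ w) \ (S ∪ T) = (u \ S) ∪ (w \ T) := by
      have hd := Finset.disjoint_left.1 h
      ext e
      simp only [mem_sdiff, mem_union]
      have := @hx.1 e; have := @hx.2 e; have := @hd e
      tauto
    have h3 : Disjoint (u \ S) (w \ T) := h.mono sdiff_subset sdiff_subset
    simp only [h2, card_union_of_disjoint hST, card_union_of_disjoint h3, pow_add]
    ring

lemma bernoulliExp_map (e : κ ↪ ι) (v : Finset κ) (f : Finset ι → ℝ) :
    bernoulliExp p (v.map e) f = bernoulliExp p v (fun T => f (T.map e)) := by
  simp only [bernoulliExp]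
  symm
  refine sum_bij (fun T _ => T.map e) ?_ ?_ ?_ ?_
  · simp
  · intro a _ b _ h
    exact map_injective e h
  · intro S hS
    obtain ⟨T, hT, rfl⟩ := subset_map_iff.1 (mem_powerset.1 hS)
    exact ⟨T, mem_powerset.2 hT, rfl⟩
  · intro T hT
    simp only [card_map]
    rw [← Finset.map_sdiff, card_map]

lemma bernoulliExp_disjoint {F : Finset ι} (hF : F ⊆ u) :
    bernoulliExp p u (fun S => if Disjoint S F then 1 else 0) = (1 - p) ^ #F := by
  have h := bernoulliExp_prod p u (fun e => if e ∈ F then 0 else 1) (fun _ => 1)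
  simp only [prod_const_one, mul_one] at h
  rw [show (fun S : Finset ι => if Disjoint S F then (1 : ℝ) else 0) =
    fun S => ∏ e ∈ S, if e ∈ F then (0 : ℝ) else 1 from ?_, h]
  · rw [← prod_subset hF]
    · rw [← prod_const]
      exact prod_congr rfl fun e he => by simp [he]
    · intro e _ he
      simp [he]
  · ext S
    split_ifs with h
    · exact (prod_eq_one fun e he => by simp [Finset.disjoint_left.1 h he]).symm
    · obtain ⟨e, he, he'⟩ := Finset.not_disjoint_iff.1 h
      exact (prod_eq_zero he (by simp [he'])).symm

end Bernoulli

/-! ### The binomial random graph -/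

section RandomGraph

open scoped Classical

variable {V : Type*} [Fintype V] {p : ℝ}

/-- The expectation of `f G` for the binomial random graph `G` with vertex set `V` and edge
probability `p`. -/
noncomputable def graphExp (p : ℝ) (f : SimpleGraph V → ℝ) : ℝ :=
  bernoulliExp p (univ.filter fun e : Sym2 V => ¬ e.IsDiag)
    (fun S => f (SimpleGraph.fromEdgeSet (S : Set (Sym2 V))))

/-- The probability of the event `P` for the binomial random graph with vertex set `V` and edge
probability `p`. -/
noncomputable def graphProb (p : ℝ) (P : SimpleGraph V → Prop) : ℝ :=
  graphExp p (fun G => if P G then 1 else 0)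

lemma graphExp_mono (hp0 : 0 ≤ p) (hp1 : p ≤ 1) {f g : SimpleGraph V → ℝ}
    (h : ∀ G, f G ≤ g G) : graphExp p f ≤ graphExp p g :=
  bernoulliExp_mono hp0 hp1 fun _ _ => h _

lemma graphExp_sum {β : Type*} (s : Finset β) (f : β → SimpleGraph V → ℝ) :
    graphExp p (fun G => ∑ b ∈ s, f b G) = ∑ b ∈ s, graphExp p (f b) :=
  bernoulliExp_sum _ _

lemma graphExp_const_mul (c : ℝ) (f : SimpleGraph V → ℝ) :
    graphExp p (fun G => c * f G) = c * graphExp p f :=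
  bernoulliExp_const_mul _ _

lemma graphExp_add (f g : SimpleGraph V → ℝ) :
    graphExp p (fun G => f G + g G) = graphExp p f + graphExp p g := by
  simp only [graphExp, bernoulliExp, mul_add, sum_add_distrib]

lemma graphExp_const (c : ℝ) : graphExp p (fun _ : SimpleGraph V => c) = c :=
  bernoulliExp_const _

lemma graphProb_mono (hp0 : 0 ≤ p) (hp1 : p ≤ 1) {P Q : SimpleGraph V → Prop}
    (h : ∀ G, P G → Q G) : graphProb p P ≤ graphProb p Q := by
  refine graphExp_mono hp0 hp1 fun G => ?_
  by_cases hP : P G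
  · simp [hP, h G hP]
  · simp only [hP, if_false]; split_ifs <;> norm_num

lemma graphProb_or_le (hp0 : 0 ≤ p) (hp1 : p ≤ 1) (P Q : SimpleGraph V → Prop) :
    graphProb p (fun G => P G ∨ Q G) ≤ graphProb p P + graphProb p Q := by
  rw [graphProb, graphProb, graphProb, ← graphExp_add]
  refine graphExp_mono hp0 hp1 fun G => ?_
  by_cases hP : P G <;> by_cases hQ : Q G <;> simp [hP, hQ]

lemma graphProb_exists_le (hp0 : 0 ≤ p) (hp1 : p ≤ 1) {β : Type*} (s : Finset β)
    (P : β → SimpleGraph V → Prop) :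
    graphProb p (fun G => ∃ b ∈ s, P b G) ≤ ∑ b ∈ s, graphProb p (P b) := by
  simp only [graphProb]
  rw [← graphExp_sum]
  refine graphExp_mono hp0 hp1 fun G => ?_
  split_ifs with h
  · obtain ⟨b, hb, hP⟩ := h
    refine le_trans ?_ (single_le_sum (f := fun b => if P b G then (1 : ℝ) else 0)
      (fun i _ => by split_ifs <;> norm_num) hb)
    simp [hP]
  · exact sum_nonneg fun i _ => by split_ifs <;> norm_num

/-- Markov's inequality, for the exponential of a real function of the graph. -/
lemma graphProb_le_exp_mul (hp0 : 0 ≤ p) (hp1 : p ≤ 1) {P : SimpleGraph V → Prop}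
    {f : SimpleGraph V → ℝ} (c : ℝ) (h : ∀ G, P G → c ≤ f G) :
    graphProb p P ≤ Real.exp (-c) * graphExp p (fun G => Real.exp (f G)) := by
  rw [← graphExp_const_mul]
  refine graphExp_mono hp0 hp1 fun G => ?_
  rw [← Real.exp_add]
  split_ifs with hP
  · exact Real.one_le_exp (by linarith [h G hP])
  · positivity

open ENNReal NNReal in
lemma binomialRandom_eq_ofReal_graphProb (p : unitInterval) (P : SimpleGraph V → Prop) :
    SimpleGraph.binomialRandom V p {G | P G} = ENNReal.ofReal (graphProb (p : ℝ) P) := by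
  have hfin : {G : SimpleGraph V | P G} = ((univ.filter P : Finset (SimpleGraph V)) : Set _) := by
    ext; simp
  have : MeasurableSingletonClass (SimpleGraph V) := ⟨fun G => by
    have h : ({G} : Set (SimpleGraph V)) = SimpleGraph.edgeSet ⁻¹' {G.edgeSet} := by
      ext H
      simp
    rw [h]
    exact SimpleGraph.measurable_edgeSet (measurableSet_singleton _)⟩
  rw [hfin, ← MeasureTheory.sum_measure_singleton]
  simp only [SimpleGraph.binomialRandom_singleton]
  have hp1 : (0 : ℝ) ≤ 1 - p := by linarith [p.2.2]
  have hw : ∀ G : SimpleGraph V, ((unitInterval.toNNReal p : ℝ≥0∞) ^ G.edgeSet.ncard *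
      (unitInterval.toNNReal (unitInterval.symm p) : ℝ≥0∞) ^
        ((Nat.card V).choose 2 - G.edgeSet.ncard)) =
      ENNReal.ofReal ((p : ℝ) ^ #G.edgeFinset * (1 - (p : ℝ)) ^
        #((univ.filter fun e : Sym2 V => ¬ e.IsDiag) \ G.edgeFinset)) := by
    intro G
    have h1 : G.edgeSet.ncard = #G.edgeFinset := by
      rw [← SimpleGraph.coe_edgeFinset, Set.ncard_coe_finset]
    have h2 : G.edgeFinset ⊆ univ.filter fun e : Sym2 V => ¬ e.IsDiag := by
      intro e he
      simp only [mem_filter, mem_univ, true_and]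
      exact G.not_isDiag_of_mem_edgeFinset he
    have h3 : #(univ.filter fun e : Sym2 V => ¬ e.IsDiag) = (Nat.card V).choose 2 := by
      rw [Nat.card_eq_fintype_card, ← Sym2.card_subtype_not_diag, Fintype.card_subtype]
    rw [card_sdiff_of_subset h2, h3, h1, ENNReal.ofReal_mul (pow_nonneg p.2.1 _),
      ENNReal.ofReal_pow p.2.1, ENNReal.ofReal_pow hp1]
    congr 2
    · rw [← ENNReal.ofReal_coe_nnreal]; rfl
    · rw [← ENNReal.ofReal_coe_nnreal]; rfl
  simp only [hw]
  rw [← ENNReal.ofReal_sum_of_nonneg fun G _ =>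
    mul_nonneg (pow_nonneg p.2.1 _) (pow_nonneg hp1 _)]
  congr 1
  rw [graphProb, graphExp, bernoulliExp, sum_filter]
  refine sum_bij' (fun G _ => G.edgeFinset) (fun S _ => SimpleGraph.fromEdgeSet (S : Set (Sym2 V)))
    ?_ ?_ ?_ ?_ ?_
  · intro G _
    rw [mem_powerset]
    intro e he
    simp only [mem_filter, mem_univ, true_and]
    exact G.not_isDiag_of_mem_edgeFinset he
  · simp
  · intro G _
    simp
  · intro S hS
    ext e
    have he : e ∈ S → ¬ e.IsDiag := fun h => by
      simpa using mem_powerset.1 hS h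
    simpa using he
  · intro G _
    simp

/-- The part of the graph outside the vertex `v` and the neighbourhood of `v` are independent: the
neighbourhood is a random subset of the other vertices. -/
lemma graphExp_eq_star (v : V) (f : SimpleGraph V → ℝ) :
    graphExp p f = bernoulliExp p (univ.filter fun e : Sym2 V => ¬ e.IsDiag ∧ v ∉ e)
      (fun S => bernoulliExp p (univ.erase v) (fun T =>
        f (SimpleGraph.fromEdgeSet ((S : Set (Sym2 V)) ∪ (fun x => s(v, x)) '' (T : Set V))))) := by
  have hinj : Function.Injective fun x : V => s(v, x) := by
    intro x y h
    exact Sym2.congr_right.1 h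
  have hE : (univ.filter fun e : Sym2 V => ¬ e.IsDiag) =
      (univ.filter fun e : Sym2 V => ¬ e.IsDiag ∧ v ∉ e) ∪ (univ.erase v).map ⟨_, hinj⟩ := by
    ext e
    simp only [mem_filter, mem_univ, true_and, mem_union, mem_map, mem_erase,
      Function.Embedding.coeFn_mk]
    constructor
    · intro he
      by_cases hv : v ∈ e
      · obtain ⟨y, rfl⟩ := Sym2.mem_iff_exists.1 hv
        refine Or.inr ⟨y, ⟨?_, trivial⟩, rfl⟩
        rintro rfl
        simp at he
      · exact Or.inl ⟨he, hv⟩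
    · rintro (h | ⟨y, ⟨hy, -⟩, rfl⟩)
      · exact h.1
      · simpa using fun h => hy h.symm
  have hd : Disjoint (univ.filter fun e : Sym2 V => ¬ e.IsDiag ∧ v ∉ e)
      ((univ.erase v).map ⟨_, hinj⟩) := by
    rw [Finset.disjoint_left]
    intro e he
    simp only [mem_filter, mem_univ, true_and] at he
    simp only [mem_map, not_exists, not_and, Function.Embedding.coeFn_mk]
    rintro x - rfl
    simp at he
  rw [graphExp, hE, bernoulliExp_union hd]
  refine bernoulliExp_congr fun S _ => ?_
  rw [bernoulliExp_map]
  refine bernoulliExp_congr fun T _ => ?_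
  simp

end RandomGraph

/-! ### Tail bounds for degrees, boundaries and sums over a neighbourhood -/

section Tails

open scoped Classical

lemma exp_le_one_add_two_mul {z : ℝ} (h0 : 0 ≤ z) (h1 : z ≤ 1) : Real.exp z ≤ 1 + 2 * z := by
  have h := (abs_le.1 (Real.abs_exp_sub_one_sub_id_le (x := z) (by rwa [abs_of_nonneg h0]))).2
  nlinarith

lemma exp_neg_le_one_sub_half {z : ℝ} (h0 : 0 ≤ z) (h1 : z ≤ 1) :
    Real.exp (-z) ≤ 1 - z / 2 := by
  rw [Real.exp_neg, inv_le_comm₀ (Real.exp_pos z) (by linarith)]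
  refine le_trans ?_ (Real.add_one_le_exp z)
  rw [inv_le_comm₀ (by linarith) (by linarith), inv_le_iff_one_le_mul₀ (by linarith)]
  nlinarith

lemma bernoulliExp_exp_sum_le {ι : Type*} [DecidableEq ι] {p : ℝ} (hp0 : 0 ≤ p) (u : Finset ι)
    (z : ι → ℝ) (h0 : ∀ x, 0 ≤ z x) (h1 : ∀ x, z x ≤ 1) :
    bernoulliExp p u (fun T => Real.exp (∑ x ∈ T, z x)) ≤ Real.exp (2 * p * ∑ x ∈ u, z x) := by
  have h := bernoulliExp_prod p u (fun x => Real.exp (z x)) (fun _ => 1)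
  simp only [prod_const_one, mul_one, ← Real.exp_sum] at h
  rw [h, mul_sum, Real.exp_sum]
  refine prod_le_prod (fun x _ => ?_) fun x _ => ?_
  · nlinarith [Real.one_le_exp (h0 x)]
  · have := exp_le_one_add_two_mul (h0 x) (h1 x)
    have := Real.add_one_le_exp (2 * p * z x)
    nlinarith

variable {V : Type*} [Fintype V] {p : ℝ}

lemma fromEdgeSet_union_star_adj (v : V) {S : Finset (Sym2 V)} {T : Finset V}
    (hS : S ⊆ univ.filter fun e : Sym2 V => ¬ e.IsDiag ∧ v ∉ e) (hT : T ⊆ univ.erase v) (x : V) :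
    (SimpleGraph.fromEdgeSet ((S : Set (Sym2 V)) ∪ (fun x => s(v, x)) '' (T : Set V))).Adj v x ↔
      x ∈ T := by
  rw [SimpleGraph.fromEdgeSet_adj]
  constructor
  · rintro ⟨h | ⟨y, hy, h⟩, -⟩
    · have := hS h
      simp at this
    · obtain rfl : y = x := Sym2.congr_right.1 h
      exact hy
  · intro hx
    exact ⟨Or.inr ⟨x, hx, rfl⟩, (ne_of_mem_erase (hT hx)).symm⟩

lemma deleteIncidenceSet_fromEdgeSet_union_star (v : V) {S : Finset (Sym2 V)} {T : Finset V}
    (hS : S ⊆ univ.filter fun e : Sym2 V => ¬ e.IsDiag ∧ v ∉ e) :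
    (SimpleGraph.fromEdgeSet
      ((S : Set (Sym2 V)) ∪ (fun x => s(v, x)) '' (T : Set V))).deleteIncidenceSet v =
      SimpleGraph.fromEdgeSet (S : Set (Sym2 V)) := by
  ext a b
  rw [SimpleGraph.deleteIncidenceSet_adj, SimpleGraph.fromEdgeSet_adj,
    SimpleGraph.fromEdgeSet_adj]
  constructor
  · rintro ⟨⟨h | ⟨y, -, h⟩, hne⟩, ha, hb⟩
    · exact ⟨h, hne⟩
    · rcases Sym2.eq_iff.1 h with h | h
      · exact absurd h.1.symm ha
      · exact absurd h.1.symm hb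
  · rintro ⟨h, hne⟩
    have := hS h
    simp only [mem_filter, Sym2.mem_iff, not_or] at this
    exact ⟨⟨Or.inl h, hne⟩, Ne.symm this.2.2.1, Ne.symm this.2.2.2⟩

/-- A Chernoff bound for the sum of a weight over the neighbours of `v`. The weight may depend on
the graph outside `v`, because the neighbourhood of `v` is independent of it. -/
lemma graphProb_star_sum_le (hp0 : 0 ≤ p) (hp1 : p ≤ 1) (v : V) (g : SimpleGraph V → V → ℝ)
    (B y : ℝ) (h0 : ∀ H x, 0 ≤ g H x) (h1 : ∀ H x, g H x ≤ 1) (hB : ∀ H, ∑ x, g H x ≤ B) :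
    graphProb p (fun G => y ≤ ∑ x with G.Adj v x, g (G.deleteIncidenceSet v) x) ≤
      Real.exp (2 * p * B - y) := by
  refine (graphProb_le_exp_mul hp0 hp1 y fun G hG => hG).trans ?_
  rw [show 2 * p * B - y = -y + 2 * p * B by ring, Real.exp_add]
  refine mul_le_mul_of_nonneg_left ?_ (Real.exp_pos _).le
  rw [graphExp_eq_star v]
  calc _ ≤ bernoulliExp p (univ.filter fun e : Sym2 V => ¬ e.IsDiag ∧ v ∉ e)
        (fun _ => Real.exp (2 * p * B)) := by
        refine bernoulliExp_mono hp0 hp1 fun S hS => ?_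
        refine le_trans (le_of_eq ?_) ((bernoulliExp_exp_sum_le hp0 (univ.erase v)
          (g (SimpleGraph.fromEdgeSet (S : Set (Sym2 V)))) (h0 _) (h1 _)).trans ?_)
        · refine bernoulliExp_congr fun T hT => ?_
          rw [deleteIncidenceSet_fromEdgeSet_union_star v hS]
          congr 1
          refine sum_congr ?_ fun _ _ => rfl
          ext x
          simp only [mem_filter, mem_univ, true_and]
          exact fromEdgeSet_union_star_adj v hS hT x
        · refine Real.exp_le_exp.2 (mul_le_mul_of_nonneg_left ?_ (by linarith))
          exact (sum_le_sum_of_subset_of_nonneg (subset_univ _) fun _ _ _ => h0 _ _).trans (hB _)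
    _ = _ := bernoulliExp_const _

lemma graphProb_degree_ge_le (hp0 : 0 ≤ p) (hp1 : p ≤ 1) (v : V) :
    graphProb p (fun G => 4 * (Fintype.card V * p) ≤ #{x | G.Adj v x}) ≤
      Real.exp (-(2 * (Fintype.card V * p))) := by
  have h := graphProb_star_sum_le hp0 hp1 v (fun _ _ => 1) (Fintype.card V)
    (4 * (Fintype.card V * p)) (by simp) (by simp) (by simp)
  simp only [sum_const, nsmul_eq_mul, mul_one] at h
  refine h.trans (Real.exp_le_exp.2 ?_)
  linarith

lemma graphProb_no_edges {A Y : Finset V} (h : Disjoint A Y) :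
    graphProb p (fun G => ∀ a ∈ A, ∀ x ∈ Y, ¬ G.Adj a x) = (1 - p) ^ (#A * #Y) := by
  have hne : ∀ a ∈ A, ∀ x ∈ Y, a ≠ x := fun a ha x hx he =>
    Finset.disjoint_left.1 h ha (he ▸ hx)
  set F : Finset (Sym2 V) := (A ×ˢ Y).image fun z => s(z.1, z.2) with hF
  have hcard : #F = #A * #Y := by
    rw [hF, card_image_of_injOn, card_product]
    rintro ⟨a, x⟩ hax ⟨b, y⟩ hby he
    simp only [coe_product, Set.mem_prod, mem_coe] at hax hby
    rcases Sym2.eq_iff.1 he with he | he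
    · exact Prod.ext he.1 he.2
    · exact absurd he.1 (hne a hax.1 y hby.2)
  have hsub : F ⊆ univ.filter fun e : Sym2 V => ¬ e.IsDiag := by
    intro e he
    obtain ⟨z, hz, rfl⟩ := mem_image.1 he
    rw [mem_product] at hz
    simpa using hne _ hz.1 _ hz.2
  rw [← hcard, ← bernoulliExp_disjoint hsub, graphProb, graphExp]
  refine bernoulliExp_congr fun S hS => ?_
  congr 1
  simp only [SimpleGraph.fromEdgeSet_adj, eq_iff_iff, mem_coe, Finset.disjoint_right]
  constructor
  · intro h' e he heS
    obtain ⟨z, hz, rfl⟩ := mem_image.1 he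
    rw [mem_product] at hz
    exact h' _ hz.1 _ hz.2 ⟨heS, hne _ hz.1 _ hz.2⟩
  · intro h' a ha x hx hadj
    exact h' (mem_image.2 ⟨(a, x), mem_product.2 ⟨ha, hx⟩, rfl⟩) hadj.1

/-- The set of the vertices outside `A` that are adjacent to a vertex of `A`. -/
noncomputable def outerBoundary (G : SimpleGraph V) (A : Finset V) : Finset V :=
  {x | x ∉ A ∧ ∃ a ∈ A, G.Adj a x}

/-- The moment generating function of the size of the boundary of `A`, which is a binomial random
variable. The product over the vertices outside `A` is expanded into events without edges between
two sets, of known probability. -/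
lemma graphExp_exp_neg_boundary (A : Finset V) :
    graphExp p (fun G => Real.exp (-#(outerBoundary G A))) =
      ((1 - Real.exp (-1)) * (1 - p) ^ #A + Real.exp (-1)) ^ #Aᶜ := by
  have h1 : ∀ G : SimpleGraph V, Real.exp (-#(outerBoundary G A)) =
      ∑ Y ∈ Aᶜ.powerset, (1 - Real.exp (-1)) ^ #Y * Real.exp (-1) ^ #(Aᶜ \ Y) *
        (if ∀ a ∈ A, ∀ x ∈ Y, ¬ G.Adj a x then 1 else 0) := by
    intro G
    have h2 : Real.exp (-#(outerBoundary G A)) =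
        ∏ x ∈ Aᶜ, ((1 - Real.exp (-1)) * (if ∀ a ∈ A, ¬ G.Adj a x then 1 else 0) +
          Real.exp (-1)) := by
      have h3 : outerBoundary G A = Aᶜ.filter fun x => ¬ ∀ a ∈ A, ¬ G.Adj a x := by
        ext x; simp [outerBoundary]
      rw [h3, show -((#(Aᶜ.filter fun x => ¬ ∀ a ∈ A, ¬ G.Adj a x) : ℕ) : ℝ) =
        (#(Aᶜ.filter fun x => ¬ ∀ a ∈ A, ¬ G.Adj a x) : ℕ) * (-1 : ℝ) by ring, Real.exp_nat_mul,
        ← prod_const, prod_filter]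
      refine prod_congr rfl fun x _ => ?_
      by_cases hx : ∀ a ∈ A, ¬ G.Adj a x
      · rw [if_neg (not_not.2 hx), if_pos hx]; ring
      · rw [if_pos hx, if_neg hx]; ring
    rw [h2, prod_add]
    refine sum_congr rfl fun Y hY => ?_
    rw [prod_mul_distrib, prod_const, prod_const, prod_boole,
      mul_right_comm]
    congr 2
    exact propext ⟨fun h a ha x hx => h x hx a ha, fun h x hx a ha => h a ha x hx⟩
  simp only [h1]
  rw [graphExp_sum, ← prod_const, prod_add]
  refine sum_congr rfl fun Y hY => ?_
  rw [graphExp_const_mul]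
  have h4 := graphProb_no_edges (p := p) (A := A) (Y := Y)
    (Finset.disjoint_left.2 fun a ha hY' => by simpa [ha] using mem_powerset.1 hY hY')
  have h5 : graphExp p (fun G => if ∀ a ∈ A, ∀ x ∈ Y, ¬ G.Adj a x then (1 : ℝ) else 0) =
      (1 - p) ^ (#A * #Y) := by
    rw [← h4, graphProb]
    congr!
  rw [h5, prod_const, prod_const, mul_pow, ← pow_mul]
  ring

/-- Small sets expand: the boundary of `A` has expected size at least `#A * d / 4`, where `d`
is the expected degree, because at least half of the vertices are outside `A`. -/
lemma graphProb_boundary_small_le (hp0 : 0 ≤ p) (hp1 : p ≤ 1) (A : Finset V)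
    (hA : #A * p ≤ 1) (hA' : 2 * #A ≤ Fintype.card V) :
    graphProb p (fun G => #(outerBoundary G A) ≤ #A * (Fintype.card V * p) / 16) ≤
      Real.exp (-(Fintype.card V * p / 16)) ^ #A := by
  set n : ℝ := (Fintype.card V : ℝ) with hn
  set j : ℝ := (#A : ℝ) with hj
  have hj0 : 0 ≤ j := by positivity
  refine (graphProb_le_exp_mul hp0 hp1 (f := fun G => -#(outerBoundary G A)) (-(j * (n * p) / 16))
    fun G hG => by linarith).trans ?_
  rw [graphExp_exp_neg_boundary]
  have he : Real.exp (-1) ≤ 1 / 2 := by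
    have := exp_neg_le_one_sub_half (z := 1) (by norm_num) le_rfl
    linarith
  have h1 : (1 - p) ^ #A ≤ 1 - j * p / 2 := by
    calc (1 - p) ^ #A ≤ Real.exp (-p) ^ #A :=
          pow_le_pow_left₀ (by linarith) (Real.one_sub_le_exp_neg p) _
      _ = Real.exp (-(j * p)) := by rw [← Real.exp_nat_mul]; congr 1; ring
      _ ≤ _ := exp_neg_le_one_sub_half (by positivity) hA
  have h2 : (1 - Real.exp (-1)) * (1 - p) ^ #A + Real.exp (-1) ≤ Real.exp (-(j * p / 4)) := by
    have := Real.one_sub_le_exp_neg (j * p / 4)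
    have : 0 ≤ j * p := by positivity
    nlinarith
  have hc : n / 2 ≤ (#Aᶜ : ℝ) := by
    have h4 : (#A : ℝ) + #Aᶜ = n := by rw [hn]; exact_mod_cast card_add_card_compl A
    have h5 : (2 : ℝ) * #A ≤ n := by rw [hn]; exact_mod_cast hA'
    linarith
  have h0 : 0 ≤ (1 - Real.exp (-1)) * (1 - p) ^ #A + Real.exp (-1) := by
    have : 0 ≤ (1 - p) ^ #A := pow_nonneg (by linarith) _
    have := Real.exp_pos (-1)
    nlinarith
  calc _ ≤ Real.exp (- -(j * (n * p) / 16)) * Real.exp (-(j * p / 4)) ^ #Aᶜ :=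
        mul_le_mul_of_nonneg_left (pow_le_pow_left₀ h0 h2 _) (Real.exp_pos _).le
    _ ≤ _ := by
        rw [← Real.exp_nat_mul, ← Real.exp_nat_mul, ← Real.exp_add]
        refine Real.exp_le_exp.2 ?_
        have : 0 ≤ j * p := by positivity
        nlinarith [mul_le_mul_of_nonneg_left hc this]

lemma graphProb_no_boundary_le (hp0 : 0 ≤ p) (hp1 : p ≤ 1) (A : Finset V)
    (hA' : 2 * #A ≤ Fintype.card V) :
    graphProb p (fun G => ∀ a ∈ A, ∀ x ∈ Aᶜ, ¬ G.Adj a x) ≤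
      Real.exp (-(Fintype.card V * p / 16)) ^ #A := by
  rw [graphProb_no_edges disjoint_compl_right]
  set n : ℝ := (Fintype.card V : ℝ) with hn
  have hc : n / 2 ≤ (#Aᶜ : ℝ) := by
    have h4 : (#A : ℝ) + #Aᶜ = n := by rw [hn]; exact_mod_cast card_add_card_compl A
    have h5 : (2 : ℝ) * #A ≤ n := by rw [hn]; exact_mod_cast hA'
    linarith
  rw [mul_comm, pow_mul]
  refine pow_le_pow_left₀ (pow_nonneg (by linarith) _) ?_ _
  calc (1 - p) ^ #Aᶜ ≤ Real.exp (-p) ^ #Aᶜ :=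
        pow_le_pow_left₀ (by linarith) (Real.one_sub_le_exp_neg p) _
    _ ≤ _ := by
        rw [← Real.exp_nat_mul]
        refine Real.exp_le_exp.2 ?_
        have : 0 ≤ n := by positivity
        nlinarith [mul_le_mul_of_nonneg_right hc hp0, mul_nonneg this hp0]

/-- The union bound over all nonempty sets `A`, for events of probability at most `x ^ #A`. -/
lemma sum_nonempty_pow_card_le {x : ℝ} (hx : 0 ≤ x) :
    ∑ A : Finset V with A.Nonempty, x ^ #A ≤ Real.exp (Fintype.card V * x) - 1 := by
  have h1 : ∑ A : Finset V, x ^ #A = (x + 1) ^ Fintype.card V := by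
    have := Fintype.sum_pow_mul_eq_add_pow V x 1
    simpa using this
  have h2 : ∑ A : Finset V with A.Nonempty, x ^ #A + 1 = ∑ A : Finset V, x ^ #A := by
    rw [← sum_filter_add_sum_filter_not univ (fun A : Finset V => A.Nonempty)]
    simp [Finset.not_nonempty_iff_eq_empty, Finset.filter_eq']
  have h3 : (x + 1) ^ Fintype.card V ≤ Real.exp (Fintype.card V * x) := by
    rw [Real.exp_nat_mul]
    exact pow_le_pow_left₀ (by linarith) (Real.add_one_le_exp x) _
  linarith

end Tails

/-! ### Balls in the graph metric -/

section Balls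

open scoped Classical

variable {V : Type*} [Fintype V] {G : SimpleGraph V}

/-- The closed ball of radius `j` around `v` in the graph metric. -/
noncomputable def closedBall (G : SimpleGraph V) (j : ℕ) (v : V) : Finset V :=
  {s | G.edist v s ≤ j}

lemma mem_closedBall {j : ℕ} {v s : V} : s ∈ closedBall G j v ↔ G.edist v s ≤ j := by
  simp [closedBall]

lemma mem_closedBall_comm {j : ℕ} {v s : V} : s ∈ closedBall G j v ↔ v ∈ closedBall G j s := by
  rw [mem_closedBall, mem_closedBall, SimpleGraph.edist_comm]

lemma mem_closedBall_of_walk {j : ℕ} {v s : V} (w : G.Walk v s) (h : w.length ≤ j) :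
    s ∈ closedBall G j v :=
  mem_closedBall.2 (w.edist_le.trans (by exact_mod_cast h))

lemma exists_isPath_of_mem_closedBall {j : ℕ} {v s : V} (h : s ∈ closedBall G j v) :
    ∃ w : G.Walk v s, w.IsPath ∧ w.length ≤ j := by
  rw [mem_closedBall] at h
  obtain ⟨w, hw⟩ := SimpleGraph.exists_walk_of_edist_ne_top (ne_top_of_le_ne_top (by simp) h)
  rw [← hw] at h
  exact ⟨w.bypass, w.bypass_isPath, w.length_bypass_le_length.trans (by exact_mod_cast h)⟩

lemma self_mem_closedBall (j : ℕ) (v : V) : v ∈ closedBall G j v :=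
  mem_closedBall_of_walk .nil (by simp)

lemma card_closedBall_le {Δ : ℝ} (hΔ : 0 ≤ Δ) (h : ∀ v, (#{x | G.Adj v x} : ℝ) ≤ Δ) (j : ℕ)
    (v : V) : (#(closedBall G j v) : ℝ) ≤ (1 + Δ) ^ j := by
  induction j generalizing v with
  | zero =>
    have : closedBall G 0 v ⊆ {v} := by
      intro s hs
      rw [mem_closedBall, Nat.cast_zero, nonpos_iff_eq_zero, SimpleGraph.edist_eq_zero_iff] at hs
      simp [hs]
    have := card_le_card this
    rw [pow_zero]
    exact_mod_cast this
  | succ j ih =>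
    have hsub : closedBall G (j + 1) v ⊆
        {v} ∪ ({x | G.Adj v x} : Finset V).biUnion (fun x => closedBall G j x) := by
      intro s hs
      obtain ⟨w, -, hw⟩ := exists_isPath_of_mem_closedBall hs
      cases w with
      | nil => simp
      | cons hadj w =>
        refine mem_union_right _ (mem_biUnion.2 ⟨_, by simpa using hadj, ?_⟩)
        exact mem_closedBall_of_walk w (by simpa using hw)
    have h1 : #(closedBall G (j + 1) v) ≤ 1 + ∑ x with G.Adj v x, #(closedBall G j x) :=
      (card_le_card hsub).trans ((card_union_le _ _).trans
        (add_le_add (by simp) card_biUnion_le))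
    have h2 : (#(closedBall G (j + 1) v) : ℝ) ≤
        1 + ∑ x with G.Adj v x, (#(closedBall G j x) : ℝ) := by
      exact_mod_cast h1
    have h3 : ∑ x with G.Adj v x, (#(closedBall G j x) : ℝ) ≤ Δ * (1 + Δ) ^ j := by
      refine (sum_le_sum fun x _ => ih x).trans ?_
      rw [sum_const, nsmul_eq_mul]
      exact mul_le_mul_of_nonneg_right (h v) (by positivity)
    have h4 : 1 ≤ (1 + Δ) ^ j := one_le_pow₀ (by linarith)
    rw [pow_succ]
    linarith

/-- If small sets expand by the factor `D`, then balls of radius `j` have at least `D ^ j`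
elements, as long as the balls of smaller radius are small. -/
lemma pow_le_card_closedBall {D m : ℝ} (hD : 0 ≤ D)
    (h : ∀ A : Finset V, A.Nonempty → (#A : ℝ) ≤ m → #A * D ≤ #(outerBoundary G A))
    {k : ℕ} (hm : ∀ j < k, ∀ v, (#(closedBall G j v) : ℝ) ≤ m) (v : V) :
    ∀ j ≤ k, D ^ j ≤ #(closedBall G j v) := by
  intro j
  induction j with
  | zero =>
    intro _
    have : 0 < #(closedBall G 0 v) := card_pos.2 ⟨v, self_mem_closedBall 0 v⟩
    rw [pow_zero]
    exact_mod_cast this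
  | succ j ih =>
    intro hj
    have hsub : outerBoundary G (closedBall G j v) ⊆ closedBall G (j + 1) v := by
      intro x hx
      simp only [outerBoundary, mem_filter, mem_univ, true_and] at hx
      obtain ⟨-, a, ha, hadj⟩ := hx
      obtain ⟨w, -, hw⟩ := exists_isPath_of_mem_closedBall ha
      exact mem_closedBall_of_walk (w.concat hadj) (by simpa using hw)
    calc D ^ (j + 1) = D ^ j * D := pow_succ _ _
      _ ≤ #(closedBall G j v) * D := mul_le_mul_of_nonneg_right (ih (by lia)) hD
      _ ≤ #(outerBoundary G (closedBall G j v)) :=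
        h _ ⟨v, self_mem_closedBall j v⟩ (hm j (by lia) v)
      _ ≤ _ := by exact_mod_cast card_le_card hsub

lemma exists_walk_deleteIncidenceSet {V : Type*} {G : SimpleGraph V} {v a b : V}
    (w : G.Walk a b) (h : v ∉ w.support) :
    ∃ w' : (G.deleteIncidenceSet v).Walk a b, w'.length = w.length := by
  induction w with
  | nil => exact ⟨.nil, rfl⟩
  | cons hadj w ih =>
    rw [SimpleGraph.Walk.support_cons, List.mem_cons, not_or] at h
    obtain ⟨w', hw'⟩ := ih h.2
    refine ⟨.cons (SimpleGraph.deleteIncidenceSet_adj.2 ⟨hadj, Ne.symm h.1, ?_⟩) w', by simp [hw']⟩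
    rintro rfl
    exact h.2 w.start_mem_support

/-- The vertices close to both of two non-adjacent vertices `v` and `u`, apart from those very close
to `v`, are reached from `v` through a neighbour `x ≠ u` of `v` by a path avoiding `v`, and from `u`
by a path avoiding `v`. -/
lemma closedBall_inter_subset {u v : V} (huv : u ≠ v) (hadj : ¬ G.Adj v u) (j : ℕ) :
    closedBall G (j + 1) v ∩ closedBall G (j + 2) u ⊆
      closedBall G j v ∪ ({x | G.Adj v x} : Finset V).biUnion fun x =>
        if x = u then ∅ else closedBall (G.deleteIncidenceSet v) j x ∩
          closedBall (G.deleteIncidenceSet v) (j + 2) u := by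
  intro s hs
  obtain ⟨hsv, hsu⟩ := mem_inter.1 hs
  obtain ⟨q, -, hq⟩ := exists_isPath_of_mem_closedBall hsu
  by_cases hvq : v ∈ q.support
  -- The path from `u` passes through `v` after at least two steps, since `u` and `v` are neither
  -- equal nor adjacent, so `s` is within distance `j` of `v`.
  · refine mem_union_left _ (mem_closedBall_of_walk (q.dropUntil v hvq) ?_)
    have h1 : (q.takeUntil v hvq).length + (q.dropUntil v hvq).length = q.length := by
      rw [← SimpleGraph.Walk.length_append, SimpleGraph.Walk.take_spec]
    have h2 : 2 ≤ (q.takeUntil v hvq).length := by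
      by_contra hlt
      have h3 : G.edist u v ≤ 1 := (q.takeUntil v hvq).edist_le.trans (by
        exact_mod_cast (by lia : (q.takeUntil v hvq).length ≤ 1))
      rcases SimpleGraph.edist_le_one_iff_adj_or_eq.1 h3 with h | h
      · exact hadj h.symm
      · exact huv h
    lia
  · obtain ⟨w, hwp, hw⟩ := exists_isPath_of_mem_closedBall hsv
    cases w with
    | nil => exact mem_union_left _ (self_mem_closedBall j v)
    | @cons _ x _ hvx w =>
      have hxu : x ≠ u := by
        rintro rfl
        exact hadj hvx
      rw [SimpleGraph.Walk.cons_isPath_iff] at hwp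
      obtain ⟨w', hw'⟩ := exists_walk_deleteIncidenceSet w hwp.2
      obtain ⟨q', hq'⟩ := exists_walk_deleteIncidenceSet q hvq
      refine mem_union_right _ (mem_biUnion.2 ⟨x, by simpa using hvx, ?_⟩)
      rw [if_neg hxu, mem_inter]
      rw [SimpleGraph.Walk.length_cons] at hw
      exact ⟨mem_closedBall_of_walk w' (by lia), mem_closedBall_of_walk q' (by lia)⟩

lemma connected_of_no_isolated_set [Nonempty V]
    (h : ∀ A : Finset V, A.Nonempty → 2 * #A ≤ Fintype.card V →
      ¬ ∀ a ∈ A, ∀ x ∈ Aᶜ, ¬ G.Adj a x) : G.Connected := by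
  refine ⟨fun u v => ?_⟩
  by_contra huv
  set A : Finset V := {x | G.Reachable u x} with hA
  have hno : ∀ a ∈ A, ∀ x ∈ Aᶜ, ¬ G.Adj a x := by
    intro a ha x hx hadj
    simp only [hA, mem_compl, mem_filter, mem_univ, true_and] at ha hx
    exact hx (ha.trans hadj.reachable)
  by_cases hc : 2 * #A ≤ Fintype.card V
  · exact h A ⟨u, by simp [hA]⟩ hc hno
  · refine h Aᶜ ⟨v, by simpa [hA] using huv⟩ ?_ ?_
    · have := card_add_card_compl A
      lia
    · rw [compl_compl]
      exact fun a ha x hx hadj => hno x hx a ha hadj.symm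

end Balls

/-! ### Random seed lists -/

section Seeds

open scoped Classical

variable {V : Type*} [Fintype V]

/-- The expectation of `f l`, where `l` is a list of `m` independent uniformly random elements
of `V`. -/
noncomputable def seedExp : ℕ → (List V → ℝ) → ℝ
  | 0, f => f []
  | m + 1, f => (∑ s, seedExp m fun l => f (s :: l)) / Fintype.card V

lemma seedExp_mono {m : ℕ} {f g : List V → ℝ} (h : ∀ l, l.length = m → f l ≤ g l) :
    seedExp m f ≤ seedExp m g := by
  induction m generalizing f g with
  | zero => exact h [] rfl
  | succ m ih =>
    exact div_le_div_of_nonneg_right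
      (sum_le_sum fun s _ => ih fun l hl => h _ (by simp [hl])) (by positivity)

lemma seedExp_const_mul (m : ℕ) (c : ℝ) (f : List V → ℝ) :
    seedExp m (fun l => c * f l) = c * seedExp m f := by
  induction m generalizing f with
  | zero => rfl
  | succ m ih => simp only [seedExp, ih, ← mul_sum, mul_div_assoc]

lemma seedExp_sum (m : ℕ) {β : Type*} (t : Finset β) (f : β → List V → ℝ) :
    seedExp m (fun l => ∑ b ∈ t, f b l) = ∑ b ∈ t, seedExp m (f b) := by
  induction m generalizing f with
  | zero => rfl
  | succ m ih =>
    simp only [seedExp, ih]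
    rw [sum_comm, sum_div]

lemma seedExp_add (m : ℕ) (f g : List V → ℝ) :
    seedExp m (fun l => f l + g l) = seedExp m f + seedExp m g := by
  induction m generalizing f g with
  | zero => rfl
  | succ m ih =>
    simp only [seedExp, ih, sum_add_distrib, add_div]

lemma seedExp_const [Nonempty V] (m : ℕ) (c : ℝ) : seedExp m (fun _ : List V => c) = c := by
  have : (Fintype.card V : ℝ) ≠ 0 := by simp
  induction m with
  | zero => rfl
  | succ m ih =>
    simp only [seedExp, ih, sum_const, card_univ, nsmul_eq_mul]
    field_simp

/-- A random seed list that is good on average over the random graph can be replaced by a fixed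
one. -/
lemma exists_graphExp_le_of_seedExp_le [Nonempty V] {W : Type*} [Fintype W] {p : ℝ} (m : ℕ)
    (F : SimpleGraph W → List V → ℝ) {c : ℝ}
    (h : graphExp p (fun G => seedExp m (F G)) ≤ c) :
    ∃ l : List V, l.length = m ∧ graphExp p (fun G => F G l) ≤ c := by
  induction m generalizing F with
  | zero => exact ⟨[], rfl, h⟩
  | succ m ih =>
    have hn : (0 : ℝ) < Fintype.card V := by exact_mod_cast Fintype.card_pos
    have h1 : (∑ s : V, graphExp p (fun G => seedExp m fun l => F G (s :: l))) ≤
        ∑ s : V, c := by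
      rw [← graphExp_sum, sum_const, card_univ, nsmul_eq_mul]
      simp only [seedExp, div_eq_inv_mul] at h
      rw [graphExp_const_mul, ← div_eq_inv_mul, div_le_iff₀ hn] at h
      linarith
    obtain ⟨s, -, hs⟩ := exists_le_of_sum_le univ_nonempty h1
    obtain ⟨l, hl, hl'⟩ := ih (fun G l => F G (s :: l)) hs
    exact ⟨s :: l, by simp [hl], hl'⟩

/-- The number of elements of the list that are read, in order, until `t` elements with property `N`
have been met. -/
noncomputable def stopTime {V : Type*} (N : V → Prop) : List V → ℕ → ℕ
  | [], _ => 0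
  | _ :: _, 0 => 0
  | s :: l, t + 1 => stopTime N l (if N s then t else t + 1) + 1

/-- At least `t` elements of the list have property `N`, and the first `t` of them all have
property `R`. -/
def FirstHitsIn {V : Type*} (N R : V → Prop) : List V → ℕ → Prop
  | _, 0 => True
  | [], _ + 1 => False
  | s :: l, t + 1 => (N s ∧ R s ∧ FirstHitsIn N R l t) ∨ (¬ N s ∧ FirstHitsIn N R l (t + 1))

lemma exists_mem_take_stopTime {V : Type*} {N R : V → Prop} {l : List V} {t : ℕ}
    (h1 : stopTime N l t < l.length) (h2 : ¬ FirstHitsIn N R l t) :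
    ∃ s ∈ l.take (stopTime N l t), N s ∧ ¬ R s := by
  induction l generalizing t with
  | nil => simp at h1
  | cons s l ih =>
    cases t with
    | zero => simp [FirstHitsIn] at h2
    | succ t =>
      simp only [stopTime, List.length_cons, add_lt_add_iff_right] at h1
      simp only [FirstHitsIn, not_or, not_and] at h2
      simp only [stopTime, List.take_succ_cons, List.mem_cons]
      by_cases hN : N s
      · rw [if_pos hN] at h1 ⊢
        by_cases hR : R s
        · obtain ⟨x, hx, hx'⟩ := ih h1 (h2.1 hN hR)
          exact ⟨x, Or.inr hx, hx'⟩
        · exact ⟨s, Or.inl rfl, hN, hR⟩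
      · rw [if_neg hN] at h1 ⊢
        obtain ⟨x, hx, hx'⟩ := ih h1 (h2.2 hN)
        exact ⟨x, Or.inr hx, hx'⟩

lemma stopTime_cons {V : Type*} (N : V → Prop) (s : V) (l : List V) (t : ℕ) :
    stopTime N (s :: l) t =
      (if t = 0 then 0 else 1) + stopTime N l (if N s then t - 1 else t) := by
  cases t with
  | zero => cases l <;> simp [stopTime]
  | succ t => simp [stopTime]; ring

/-- If only a fraction `ρ` of the elements with property `N` has property `R`, then the first `t`
elements with property `N` all have property `R` with probability at most `ρ ^ t`. -/
lemma seedExp_firstHitsIn_le [Nonempty V] (N R : V → Prop) {ρ : ℝ} (hρ : 0 ≤ ρ)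
    (h : (#{s | N s ∧ R s} : ℝ) ≤ ρ * #{s | N s}) (m t : ℕ) :
    seedExp m (fun l => if FirstHitsIn N R l t then 1 else 0) ≤ ρ ^ t := by
  have hn : (0 : ℝ) < Fintype.card V := by exact_mod_cast Fintype.card_pos
  induction m generalizing t with
  | zero =>
    cases t with
    | zero => simp [seedExp, FirstHitsIn]
    | succ t => simpa [seedExp, FirstHitsIn] using pow_nonneg hρ (t + 1)
  | succ m ih =>
    cases t with
    | zero => simp [FirstHitsIn, seedExp_const]
    | succ t =>
      rw [seedExp, div_le_iff₀ hn]
      have h1 : ∀ s : V, (seedExp m fun l => if FirstHitsIn N R (s :: l) (t + 1) then 1 else 0) ≤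
          (if N s ∧ R s then ρ ^ t else 0) + (if ¬ N s then ρ ^ (t + 1) else 0) := by
        intro s
        by_cases hN : N s
        · by_cases hR : R s
          · simpa [FirstHitsIn, hN, hR] using ih t
          · simp [FirstHitsIn, hN, hR, seedExp_const]
        · simpa [FirstHitsIn, hN] using ih (t + 1)
      refine (sum_le_sum fun s _ => h1 s).trans ?_
      rw [sum_add_distrib, ← sum_filter, ← sum_filter, sum_const, sum_const, nsmul_eq_mul,
        nsmul_eq_mul]
      have h2 : (#{s | N s} : ℝ) + #{s | ¬ N s} = Fintype.card V := by
        exact_mod_cast card_filter_add_card_filter_not (s := (univ : Finset V)) N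
      rw [← h2]
      have h3 := mul_le_mul_of_nonneg_right h (pow_nonneg hρ t)
      rw [pow_succ]
      nlinarith

/-- An exponential supermartingale bounds the total time until each vertex `v` has been hit `r v`
times. A random seed hits on average at least a proportion `a / |V|` of the vertices that are still
waiting, and never more than `b` vertices, so the expected value of `exp (- hits / b)` is at most
`exp (- a / (2 b |V|))` to the number of the waiting vertices. -/
lemma seedExp_exp_sum_stopTime_le [Nonempty V] (N : V → V → Prop) {a b : ℝ} (hb : 0 < b)
    (hNa : ∀ v, a ≤ #{s | N v s}) (hNb : ∀ s, (#{v | N v s} : ℝ) ≤ b) (m : ℕ) (r : V → ℕ) :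
    seedExp m (fun l => Real.exp (a / (2 * b * Fintype.card V) *
      ∑ v, (stopTime (N v) l (r v) : ℝ))) ≤ Real.exp ((∑ v, (r v : ℝ)) / b) := by
  have hn : (0 : ℝ) < Fintype.card V := by exact_mod_cast Fintype.card_pos
  set α := a / (2 * b * Fintype.card V) with hα
  induction m generalizing r with
  | zero =>
    simp only [seedExp, stopTime, Nat.cast_zero, sum_const_zero, mul_zero]
    exact Real.exp_le_exp.2 (by positivity)
  | succ m ih =>
    set w : ℝ := ((#{v | r v ≠ 0} : ℕ) : ℝ) with hw
    set x : V → ℝ := fun s => ((#{v | r v ≠ 0 ∧ N v s} : ℕ) : ℝ) with hx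
    have h1 : ∀ s, seedExp m (fun l => Real.exp (α * ∑ v, (stopTime (N v) (s :: l) (r v) : ℝ))) ≤
        Real.exp (α * w) * (Real.exp ((∑ v, (r v : ℝ)) / b) * (1 - x s / b / 2)) := by
      intro s
      have h2 : ∀ l, Real.exp (α * ∑ v, (stopTime (N v) (s :: l) (r v) : ℝ)) =
          Real.exp (α * w) *
            Real.exp (α * ∑ v, (stopTime (N v) l (if N v s then r v - 1 else r v) : ℝ)) := by
        intro l
        rw [← Real.exp_add, ← mul_add]
        congr 2
        simp only [stopTime_cons, Nat.cast_add, sum_add_distrib]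
        congr 1
        rw [hw, card_filter]
        push_cast
        exact sum_congr rfl fun v _ => by split_ifs <;> simp_all
      simp only [h2]
      rw [seedExp_const_mul]
      refine mul_le_mul_of_nonneg_left ((ih _).trans ?_) (Real.exp_pos _).le
      have h3 : (∑ v, ((if N v s then r v - 1 else r v : ℕ) : ℝ)) = ∑ v, (r v : ℝ) - x s := by
        rw [eq_sub_iff_add_eq, hx]
        simp only
        rw [card_filter]
        push_cast
        rw [← sum_add_distrib]
        refine sum_congr rfl fun v _ => ?_
        by_cases hN : N v s
        · cases hr : r v <;> simp [hN]
        · simp [hN]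
      rw [h3, sub_div, sub_eq_add_neg, Real.exp_add]
      refine mul_le_mul_of_nonneg_left (exp_neg_le_one_sub_half (by positivity) ?_)
        (Real.exp_pos _).le
      rw [div_le_one hb]
      refine le_trans ?_ (hNb s)
      exact Nat.cast_le.2 (card_le_card fun v hv => by
        simp only [mem_filter, mem_univ, true_and] at hv ⊢
        exact hv.2)
    have h4 : a * w ≤ ∑ s, x s := by
      have : ∑ s, x s = ∑ v with r v ≠ 0, (#{s | N v s} : ℝ) := by
        simp only [hx, card_filter, sum_filter]
        push_cast
        rw [sum_comm]
        refine sum_congr rfl fun v _ => ?_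
        by_cases hr : r v = 0 <;> simp [hr]
      rw [this, hw, mul_comm, ← nsmul_eq_mul, ← sum_const]
      exact sum_le_sum fun v _ => hNa v
    rw [seedExp, div_le_iff₀ hn]
    refine (sum_le_sum fun s _ => h1 s).trans ?_
    rw [← mul_sum, ← mul_sum, sum_sub_distrib, sum_const, card_univ, nsmul_eq_mul, mul_one,
      ← sum_div, ← sum_div]
    have h5 : (Fintype.card V : ℝ) - (∑ s, x s) / b / 2 ≤
        Fintype.card V * Real.exp (-(α * w)) := by
      have h6 := Real.one_sub_le_exp_neg (α * w)
      have h7 : Fintype.card V * (α * w) = a * w / b / 2 := by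
        rw [hα]; field_simp
      have h8 : a * w / b / 2 ≤ (∑ s, x s) / b / 2 := by gcongr
      nlinarith
    calc _ ≤ Real.exp (α * w) * (Real.exp ((∑ v, (r v : ℝ)) / b) *
          (Fintype.card V * Real.exp (-(α * w)))) := by gcongr
      _ = _ := by
        rw [Real.exp_neg]
        field_simp

end Seeds

/-! ### The adaptive algorithm -/

section Algorithm

open scoped Classical

variable {V : Type*}

/-- Query the distances of `v` from the elements of a list, in order, until `t` of these distances
are at most `k`, and continue with `c`, which receives the list of the elements read, together with
their distances from `v`. -/
noncomputable def scan (k : ℕ) (v : V) :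
    List V → ℕ → (List (V × ℕ∞) → QueryAlgorithm V) → QueryAlgorithm V
  | [], _, c => c []
  | _ :: _, 0, c => c []
  | s :: l, t + 1, c =>
    if h : s = v then scan k v l t fun K => c ((s, 0) :: K)
    else .query s v h fun a => scan k v l (if a ≤ k then t else t + 1) fun K => c ((s, a) :: K)

/-- Run `scan` for each vertex of a list, and continue with `c`, which receives what has been learnt
about each vertex. -/
noncomputable def scanAll (k : ℕ) (l : List V) (t : ℕ) :
    List V → ((V → List (V × ℕ∞)) → QueryAlgorithm V) → QueryAlgorithm V
  | [], c => c fun _ => []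
  | v :: vs, c => scan k v l t fun Kv => scanAll k l t vs fun K => c (Function.update K v Kv)

/-- Query all the pairs of distinct vertices in a list. -/
noncomputable def queryAll : List (V × V) → QueryAlgorithm V
  | [] => .halt
  | (u, v) :: L => if h : u = v then queryAll L else .query u v h fun _ => queryAll L

/-- Some vertex is known to have distances from `u` and `v` that differ by at least two, so that `u`
and `v` are not adjacent. The strict inequalities keep two infinite distances from counting as
different. -/
def Resolved (K : V → List (V × ℕ∞)) (u v : V) : Prop :=
  ∃ s a b, (s, a) ∈ K u ∧ (s, b) ∈ K v ∧ (a + 1 < b ∨ b + 1 < a)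

/-- The algorithm: each vertex is compared with the vertices of the list `l` until `t` of them have
been found at distance at most `k`, and then all the pairs that these distances do not show to be
non-adjacent are queried. -/
noncomputable def seedAlgorithm [Fintype V] (k : ℕ) (l : List V) (t : ℕ) : QueryAlgorithm V :=
  scanAll k l t univ.toList fun K =>
    queryAll ({z : V × V | z.1 ≠ z.2 ∧ ¬ Resolved K z.1 z.2} : Finset (V × V)).toList

/-- The seeds that are compared with `v`. -/
noncomputable def seedsRead [Fintype V] (G : SimpleGraph V) (k : ℕ) (l : List V) (t : ℕ) (v : V) :
    List V :=
  l.take (stopTime (fun s => s ∈ closedBall G k v) l t)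

/-- What `scan` learns about `v` if the hidden graph is `G`. -/
noncomputable def scanResult [Fintype V] (G : SimpleGraph V) (k : ℕ) (l : List V) (t : ℕ) (v : V) :
    List (V × ℕ∞) :=
  (seedsRead G k l t v).map fun s => (s, G.edist s v)

variable [Fintype V] {G : SimpleGraph V} {k t : ℕ} {l : List V}

/-- The queries of `scan` do not depend on the continuation. A seed equal to `v` is read without a
query. -/
lemma queries_scan (G : SimpleGraph V) (k : ℕ) (v : V) (l : List V) (t : ℕ) :
    ∃ Q : List (Sym2 V), Q.length ≤ stopTime (fun s => s ∈ closedBall G k v) l t ∧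
      (∀ s ∈ seedsRead G k l t v, s ≠ v → s(s, v) ∈ Q) ∧
      ∀ c, (scan k v l t c).queries G = Q ++ (c (scanResult G k l t v)).queries G := by
  induction l generalizing t with
  | nil => exact ⟨[], by simp, by simp [seedsRead], fun c => by simp [scan, scanResult, seedsRead]⟩
  | cons s l ih =>
    cases t with
    | zero =>
      exact ⟨[], by simp, by simp [seedsRead, stopTime], fun c => by
        simp [scan, scanResult, seedsRead, stopTime]⟩
    | succ t =>
      by_cases hs : s = v
      · subst hs
        have hN := self_mem_closedBall (G := G) k s
        obtain ⟨Q, h1, h2, h3⟩ := ih t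
        refine ⟨Q, ?_, ?_, fun c => ?_⟩
        · simp only [stopTime, if_pos hN]
          lia
        · intro x hx hxs
          simp only [seedsRead, stopTime, if_pos hN, List.take_succ_cons, List.mem_cons] at hx
          exact h2 x (hx.resolve_left hxs) hxs
        · simp only [scan, dif_pos, h3, scanResult, seedsRead, stopTime, if_pos hN,
            List.take_succ_cons, List.map_cons, SimpleGraph.edist_self]
      · have hN : s ∈ closedBall G k v ↔ G.edist s v ≤ k := by
          rw [mem_closedBall, SimpleGraph.edist_comm]
        obtain ⟨Q, h1, h2, h3⟩ := ih (if G.edist s v ≤ k then t else t + 1)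
        refine ⟨s(s, v) :: Q, ?_, ?_, fun c => ?_⟩
        · simp only [stopTime, List.length_cons, hN]
          lia
        · intro x hx hxv
          simp only [seedsRead, stopTime, List.take_succ_cons, List.mem_cons, hN] at hx
          rcases hx with rfl | hx
          · exact List.mem_cons_self
          · refine List.mem_cons_of_mem _ (h2 x ?_ hxv)
            simpa only [seedsRead, hN] using hx
        · simp only [scan, dif_neg hs, QueryAlgorithm.queries, h3, scanResult, seedsRead, stopTime,
            List.take_succ_cons, List.map_cons, hN, List.cons_append]

lemma queries_scanAll (G : SimpleGraph V) (k : ℕ) (l : List V) (t : ℕ) (vs : List V) :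
    ∃ Q : List (Sym2 V),
      Q.length ≤ (vs.map fun v => stopTime (fun s => s ∈ closedBall G k v) l t).sum ∧
      (∀ v ∈ vs, ∀ s ∈ seedsRead G k l t v, s ≠ v → s(s, v) ∈ Q) ∧
      ∀ c, (scanAll k l t vs c).queries G =
        Q ++ (c fun v => if v ∈ vs then scanResult G k l t v else []).queries G := by
  induction vs with
  | nil => exact ⟨[], by simp, by simp, fun c => by simp [scanAll]⟩
  | cons v vs ih =>
    obtain ⟨Q, h1, h2, h3⟩ := ih
    obtain ⟨Q', h1', h2', h3'⟩ := queries_scan G k v l t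
    refine ⟨Q' ++ Q, ?_, ?_, fun c => ?_⟩
    · simp only [List.length_append, List.map_cons, List.sum_cons]
      exact add_le_add h1' h1
    · intro u hu s hs hsu
      rcases List.mem_cons.1 hu with rfl | hu
      · exact List.mem_append_left _ (h2' s hs hsu)
      · exact List.mem_append_right _ (h2 u hu s hs hsu)
    · simp only [scanAll, h3', h3, List.append_assoc]
      congr 4
      ext1 u
      by_cases hu : u = v
      · subst hu; simp
      · simp [hu]

lemma queries_queryAll {V : Type*} (G : SimpleGraph V) (L : List (V × V)) :
    ((queryAll L).queries G).length ≤ L.length ∧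
      ∀ u v, u ≠ v → (u, v) ∈ L → s(u, v) ∈ (queryAll L).queries G := by
  induction L with
  | nil => simp [queryAll, QueryAlgorithm.queries]
  | cons z L ih =>
    obtain ⟨a, b⟩ := z
    by_cases hab : a = b
    · simp only [queryAll, dif_pos hab, List.length_cons, List.mem_cons, Prod.mk.injEq]
      refine ⟨by lia, fun u v huv h => ih.2 u v huv (h.resolve_left ?_)⟩
      rintro ⟨rfl, rfl⟩
      exact huv hab
    · simp only [queryAll, dif_neg hab, QueryAlgorithm.queries, List.length_cons, List.mem_cons,
        Prod.mk.injEq]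
      refine ⟨by lia, fun u v huv h => ?_⟩
      rcases h with ⟨rfl, rfl⟩ | h
      · exact Or.inl rfl
      · exact Or.inr (ih.2 u v huv h)

lemma not_adj_of_edist_add_one_lt {V : Type*} {G : SimpleGraph V} {s u v : V}
    (h : G.edist s u + 1 < G.edist s v) : ¬ G.Adj u v := by
  intro hadj
  have h1 : G.edist s v ≤ G.edist s u + G.edist u v := SimpleGraph.edist_triangle
  rw [SimpleGraph.edist_eq_one_iff_adj.2 hadj] at h1
  exact absurd h (not_lt.2 h1)

lemma not_adj_of_resolved {V : Type*} {G : SimpleGraph V} {K : V → List (V × ℕ∞)} {u v : V}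
    (h : Resolved K u v)
    (hu : ∀ s a, (s, a) ∈ K u → G.edist s u = a) (hv : ∀ s a, (s, a) ∈ K v → G.edist s v = a) :
    ¬ G.Adj u v := by
  obtain ⟨s, a, b, ha, hb, h⟩ := h
  rw [← hu s a ha, ← hv s b hb] at h
  rcases h with h | h
  · exact not_adj_of_edist_add_one_lt h
  · exact fun hadj => not_adj_of_edist_add_one_lt h hadj.symm

/-- The algorithm reconstructs every connected graph: each pair is either queried, or shown to be
non-adjacent by queried distances. Only the number of queries depends on the graph. -/
lemma isReconstructibleBy_seedAlgorithm {q : ℕ} (hG : G.Connected)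
    (hq : ∑ v, stopTime (fun s => s ∈ closedBall G k v) l t +
      #{z : V × V | z.1 ≠ z.2 ∧ ¬ Resolved (scanResult G k l t) z.1 z.2} ≤ q) :
    IsReconstructibleBy (seedAlgorithm k l t) q G := by
  obtain ⟨Q, h1, h2, h3⟩ := queries_scanAll G k l t univ.toList
  set L := ({z : V × V | z.1 ≠ z.2 ∧ ¬ Resolved (scanResult G k l t) z.1 z.2} :
    Finset (V × V)).toList with hL
  have h4 : (seedAlgorithm k l t).queries G = Q ++ (queryAll L).queries G := by
    rw [seedAlgorithm, h3]
    simp [hL]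
  obtain ⟨h5, h6⟩ := queries_queryAll G L
  refine ⟨?_, hG, fun G' hG' => ?_⟩
  · rw [h4, List.length_append]
    refine le_trans (add_le_add h1 h5) ?_
    rw [Finset.sum_map_toList, hL, length_toList]
    exact hq
  · have hK : ∀ v s a, (s, a) ∈ scanResult G k l t v → G.edist s v = a ∧ G'.edist s v = a := by
      intro v s a h
      obtain ⟨x, hx, he⟩ := List.mem_map.1 h
      obtain ⟨rfl, rfl⟩ := Prod.mk.inj he
      refine ⟨rfl, ?_⟩
      by_cases hxv : x = v
      · subst hxv; simp
      · refine hG' _ _ ?_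
        rw [h4]
        exact List.mem_append_left _ (h2 v (by simp) x hx hxv)
    ext u v
    by_cases huv : u = v
    · subst huv; simp
    by_cases hr : Resolved (scanResult G k l t) u v
    · exact iff_of_false (not_adj_of_resolved hr (fun s a h => (hK u s a h).2)
        fun s a h => (hK v s a h).2) (not_adj_of_resolved hr (fun s a h => (hK u s a h).1)
        fun s a h => (hK v s a h).1)
    · rw [← SimpleGraph.edist_eq_one_iff_adj, ← SimpleGraph.edist_eq_one_iff_adj, hG' u v ?_]
      rw [h4]
      refine List.mem_append_right _ (h6 u v huv ?_)
      simp [hL, huv, hr]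

/-- If both vertices have been scanned to the end, and the seeds hit by either of them do not all
lie within distance `k + 1` of the other, then the pair is resolved: a seed read for the vertex
that stops first has been read for the other one as well. -/
lemma resolved_of_not_firstHitsIn {u v : V}
    (hu : stopTime (fun s => s ∈ closedBall G k u) l t < l.length)
    (hv : stopTime (fun s => s ∈ closedBall G k v) l t < l.length)
    (huv : ¬ FirstHitsIn (fun s => s ∈ closedBall G k u) (fun s => s ∈ closedBall G (k + 1) v) l t)
    (hvu : ¬ FirstHitsIn (fun s => s ∈ closedBall G k v)
      (fun s => s ∈ closedBall G (k + 1) u) l t) :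
    Resolved (scanResult G k l t) u v := by
  have hfar : ∀ x y s : V, s ∈ closedBall G k x → s ∉ closedBall G (k + 1) y →
      G.edist s x + 1 < G.edist s y := by
    intro x y s hx hy
    rw [mem_closedBall, SimpleGraph.edist_comm] at hx hy
    refine lt_of_le_of_lt (add_le_add_left hx 1) (lt_of_not_ge fun h => hy ?_)
    exact_mod_cast h
  rcases le_total (stopTime (fun s => s ∈ closedBall G k u) l t)
    (stopTime (fun s => s ∈ closedBall G k v) l t) with h | h
  · obtain ⟨s, hs, hsu, hsv⟩ := exists_mem_take_stopTime hu huv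
    exact ⟨s, _, _, List.mem_map.2 ⟨s, hs, rfl⟩,
      List.mem_map.2 ⟨s, List.take_subset_take_left _ h hs, rfl⟩, Or.inl (hfar u v s hsu hsv)⟩
  · obtain ⟨s, hs, hsv, hsu⟩ := exists_mem_take_stopTime hv hvu
    exact ⟨s, _, _, List.mem_map.2 ⟨s, List.take_subset_take_left _ h hs, rfl⟩,
      List.mem_map.2 ⟨s, hs, rfl⟩, Or.inr (hfar v u s hsv hsu)⟩

end Algorithm

/-! ### Typical graphs and the finite form of the theorem -/

section Typical

open scoped Classical

variable {V : Type*} [Fintype V]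

/-- The properties of the random graph that the analysis of the algorithm needs: `d` is the expected
degree, `a` and `b` are bounds on the sizes of the balls of radius `k`, and two such balls (one of
them of radius `k + 1`) with non-adjacent centres have a small intersection. -/
structure IsTypical (G : SimpleGraph V) (k : ℕ) (d a b ρ : ℝ) : Prop where
  connected : G.Connected
  degree_le : ∀ v, (#{x | G.Adj v x} : ℝ) ≤ 4 * d
  le_card_closedBall : ∀ v, a ≤ #(closedBall G k v)
  card_closedBall_le : ∀ v, (#(closedBall G k v) : ℝ) ≤ b
  card_inter_le : ∀ u v, u ≠ v → ¬ G.Adj v u →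
    (#(closedBall G k v ∩ closedBall G (k + 1) u) : ℝ) ≤ ρ * a

/-- The number of the vertices other than `u` near both `x` and `u`, divided by the maximal size `M`
of a ball around `x`. It is set to zero in graphs with a vertex of degree above `Δ`, so that it is
bounded for all graphs. -/
noncomputable def overlapWeight (j : ℕ) (Δ M : ℝ) (u : V) (H : SimpleGraph V) (x : V) : ℝ :=
  if ∀ w, (#{z | H.Adj w z} : ℝ) ≤ Δ then
    #(if x = u then ∅ else closedBall H j x ∩ closedBall H (j + 2) u) / M
  else 0

lemma overlapWeight_nonneg (j : ℕ) (Δ : ℝ) {M : ℝ} (hM : 0 < M) (u : V) (H : SimpleGraph V)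
    (x : V) : 0 ≤ overlapWeight j Δ M u H x := by
  rw [overlapWeight]
  split_ifs <;> positivity

lemma overlapWeight_le_one (j : ℕ) {Δ M : ℝ} (hΔ : 0 ≤ Δ) (hM : 0 < M) (hΔM : (1 + Δ) ^ j ≤ M)
    (u : V) (H : SimpleGraph V) (x : V) : overlapWeight j Δ M u H x ≤ 1 := by
  rw [overlapWeight]
  split_ifs with h1 h2
  · simp
  · rw [div_le_one hM]
    refine le_trans ?_ ((card_closedBall_le hΔ h1 j x).trans hΔM)
    exact_mod_cast card_le_card inter_subset_left
  · norm_num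

lemma sum_overlapWeight_le (j : ℕ) {Δ M : ℝ} (hΔ : 0 ≤ Δ) (hM : 0 < M) (hΔM : (1 + Δ) ^ j ≤ M)
    (u : V) (H : SimpleGraph V) : ∑ x, overlapWeight j Δ M u H x ≤ (1 + Δ) ^ (j + 2) := by
  by_cases h : ∀ w, (#{z | H.Adj w z} : ℝ) ≤ Δ
  · simp only [overlapWeight, if_pos h]
    rw [← sum_div, div_le_iff₀ hM]
    have h1 : ∀ x : V, (#(if x = u then ∅ else closedBall H j x ∩ closedBall H (j + 2) u) : ℝ) ≤
        ∑ s ∈ closedBall H (j + 2) u, if s ∈ closedBall H j x then (1 : ℝ) else 0 := by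
      intro x
      rw [sum_boole]
      refine Nat.cast_le.2 (card_le_card ?_)
      split_ifs
      · exact empty_subset _
      · intro s hs
        rw [mem_inter] at hs
        exact mem_filter.2 hs.symm
    refine (sum_le_sum fun x _ => h1 x).trans ?_
    rw [sum_comm]
    have h2 : ∀ s : V, (∑ x, if s ∈ closedBall H j x then (1 : ℝ) else 0) ≤ M := by
      intro s
      rw [sum_boole]
      refine le_trans (Nat.cast_le.2 (card_le_card ?_)) ((card_closedBall_le hΔ h j s).trans hΔM)
      intro x hx
      exact mem_closedBall_comm.1 (mem_filter.1 hx).2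
    refine (sum_le_sum fun s _ => h2 s).trans ?_
    rw [sum_const, nsmul_eq_mul]
    exact mul_le_mul_of_nonneg_right (card_closedBall_le hΔ h _ u) hM.le
  · simp only [overlapWeight, if_neg h, sum_const_zero]
    positivity

/-- Balls around non-adjacent vertices have a small intersection if the overlap weights of the
neighbours of `v` have a small sum. -/
lemma card_closedBall_inter_le {G : SimpleGraph V} {u v : V} (huv : u ≠ v) (hadj : ¬ G.Adj v u)
    (j : ℕ) {Δ M y : ℝ} (hΔ : 0 ≤ Δ) (hM : 0 < M) (hΔM : (1 + Δ) ^ j ≤ M)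
    (hdeg : ∀ w, (#{z | G.Adj w z} : ℝ) ≤ Δ)
    (hy : ∑ x with G.Adj v x, overlapWeight j Δ M u (G.deleteIncidenceSet v) x ≤ y) :
    (#(closedBall G (j + 1) v ∩ closedBall G (j + 2) u) : ℝ) ≤ M * (1 + y) := by
  obtain ⟨H, hH⟩ : ∃ H, H = G.deleteIncidenceSet v := ⟨_, rfl⟩
  rw [← hH] at hy
  have hHdeg : ∀ w, (#{z | H.Adj w z} : ℝ) ≤ Δ := by
    intro w
    refine le_trans (Nat.cast_le.2 (card_le_card ?_)) (hdeg w)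
    intro z hz
    simp only [mem_filter, mem_univ, true_and] at hz ⊢
    rw [hH] at hz
    exact (SimpleGraph.deleteIncidenceSet_adj.1 hz).1
  simp only [overlapWeight, if_pos hHdeg] at hy
  rw [← sum_div, div_le_iff₀ hM] at hy
  have h1 := (card_le_card (closedBall_inter_subset huv hadj j)).trans
    ((card_union_le _ _).trans (add_le_add_right card_biUnion_le _))
  rw [← hH] at h1
  have h2 : (#(closedBall G (j + 1) v ∩ closedBall G (j + 2) u) : ℝ) ≤ #(closedBall G j v) +
      ∑ x with G.Adj v x,
        (#(if x = u then ∅ else closedBall H j x ∩ closedBall H (j + 2) u) : ℝ) := by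
    exact_mod_cast h1
  have h3 := (card_closedBall_le hΔ hdeg j v).trans hΔM
  linarith

/-- The random graph is typical with high probability. The first term of the bound is for the
degrees, the second one for expansion and connectedness, and the last one for the overlaps of
balls around pairs of vertices. -/
lemma graphProb_not_isTypical_le [Nonempty V] {p d y ρ : ℝ} (hp0 : 0 ≤ p) (hp1 : p ≤ 1) (j : ℕ)
    (hd : d = Fintype.card V * p) (hd1 : 1 ≤ d) (hM1 : (5 * d) ^ j * p ≤ 1)
    (hM2 : 2 * (5 * d) ^ j ≤ Fintype.card V) (hy : 4 * p * (5 * d) ^ (j + 2) ≤ y)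
    (hρ : (5 * d) ^ j * (1 + y) ≤ ρ * (d / 16) ^ (j + 1)) :
    graphProb p (fun G : SimpleGraph V =>
        ¬ IsTypical G (j + 1) d ((d / 16) ^ (j + 1)) ((5 * d) ^ (j + 1)) ρ) ≤
      Fintype.card V * Real.exp (-(2 * d)) +
        2 * (Real.exp (Fintype.card V * Real.exp (-(d / 16))) - 1) +
        Fintype.card V ^ 2 * Real.exp (-(y / 2)) := by
  have hd0 : 0 ≤ d := by linarith
  have hM0 : 0 < (5 * d) ^ j := by positivity
  have h5 : 1 + 4 * d ≤ 5 * d := by linarith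
  have h5j : ∀ i, (1 + 4 * d) ^ i ≤ (5 * d) ^ i := fun i =>
    pow_le_pow_left₀ (by linarith) h5 i
  set P1 : V → SimpleGraph V → Prop := fun v G =>
    4 * (Fintype.card V * p) ≤ #{x | G.Adj v x} with hP1
  set P2 : Finset V → SimpleGraph V → Prop := fun A G => (#A : ℝ) ≤ (5 * d) ^ j ∧
    #(outerBoundary G A) ≤ #A * (Fintype.card V * p) / 16 with hP2
  set P3 : Finset V → SimpleGraph V → Prop := fun A G => 2 * #A ≤ Fintype.card V ∧
    ∀ a ∈ A, ∀ x ∈ Aᶜ, ¬ G.Adj a x with hP3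
  set P4 : V × V → SimpleGraph V → Prop := fun z G => y ≤ ∑ x with G.Adj z.1 x,
    overlapWeight j (4 * d) ((5 * d) ^ j) z.2 (G.deleteIncidenceSet z.1) x with hP4
  have hbad : ∀ G : SimpleGraph V,
      ¬ IsTypical G (j + 1) d ((d / 16) ^ (j + 1)) ((5 * d) ^ (j + 1)) ρ →
      (((∃ v ∈ univ, P1 v G) ∨ (∃ A ∈ univ.filter Finset.Nonempty, P2 A G)) ∨
        (∃ A ∈ univ.filter Finset.Nonempty, P3 A G)) ∨ (∃ z ∈ univ, P4 z G) := by
    intro G hG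
    by_contra hcon
    simp only [not_or, not_exists, not_and, mem_univ, mem_filter, true_and] at hcon
    obtain ⟨⟨⟨h1, h2⟩, h3⟩, h4⟩ := hcon
    have hdeg : ∀ v, (#{x | G.Adj v x} : ℝ) ≤ 4 * d := fun v => by
      have := h1 v
      simp only [hP1, not_le] at this
      rw [hd]
      exact this.le
    have hball : ∀ i v, (#(closedBall G i v) : ℝ) ≤ (5 * d) ^ i := fun i v =>
      (card_closedBall_le (by positivity) hdeg i v).trans (h5j i)
    refine hG ⟨?_, hdeg, ?_, hball _, ?_⟩
    · exact connected_of_no_isolated_set fun A hA hA' hno => h3 A hA ⟨hA', hno⟩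
    · intro v
      refine pow_le_card_closedBall (m := (5 * d) ^ j) (k := j + 1) (by positivity) ?_ ?_ v _ le_rfl
      · intro A hA hAm
        have := h2 A hA
        simp only [hP2, not_and, not_le] at this
        have := this hAm
        rw [hd]
        linarith
      · intro i hi v
        exact (hball i v).trans (pow_le_pow_right₀ (by linarith) (by lia))
    · intro u v huv hadj
      have := h4 (v, u)
      simp only [hP4, not_le] at this
      exact (card_closedBall_inter_le huv hadj j (by positivity) hM0 (h5j j) hdeg this.le).trans hρ
  refine (graphProb_mono hp0 hp1 hbad).trans ?_
  refine (graphProb_or_le hp0 hp1 _ _).trans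
    (add_le_add ((graphProb_or_le hp0 hp1 _ _).trans ?_) ?_)
  · have hA : graphProb p (fun G => (∃ v ∈ univ, P1 v G)) ≤
        Fintype.card V * Real.exp (-(2 * d)) := by
      refine (graphProb_exists_le hp0 hp1 _ _).trans ((sum_le_sum fun v _ =>
        graphProb_degree_ge_le hp0 hp1 v).trans ?_)
      rw [sum_const, card_univ, nsmul_eq_mul, hd]
    have hsum := sum_nonempty_pow_card_le (V := V) (Real.exp_pos (-(d / 16))).le
    have hB : graphProb p (fun G => (∃ A ∈ univ.filter Finset.Nonempty, P2 A G)) ≤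
        Real.exp (Fintype.card V * Real.exp (-(d / 16))) - 1 := by
      refine (graphProb_exists_le hp0 hp1 _ _).trans ((sum_le_sum fun A hA => ?_).trans hsum)
      by_cases hAm : (#A : ℝ) ≤ (5 * d) ^ j
      · refine (graphProb_mono hp0 hp1 fun G h => h.2).trans ?_
        rw [hd]
        refine graphProb_boundary_small_le hp0 hp1 A
          ((mul_le_mul_of_nonneg_right hAm hp0).trans hM1) ?_
        have : 2 * (#A : ℝ) ≤ Fintype.card V := by linarith
        exact_mod_cast this
      · have : graphProb p (P2 A) = 0 := by
          simp only [graphProb, hP2, hAm, false_and, if_false]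
          exact graphExp_const 0
        rw [this]
        positivity
    have hC : graphProb p (fun G => (∃ A ∈ univ.filter Finset.Nonempty, P3 A G)) ≤
        Real.exp (Fintype.card V * Real.exp (-(d / 16))) - 1 := by
      refine (graphProb_exists_le hp0 hp1 _ _).trans ((sum_le_sum fun A hA => ?_).trans hsum)
      by_cases hAm : 2 * #A ≤ Fintype.card V
      · refine (graphProb_mono hp0 hp1 fun G h => h.2).trans ?_
        rw [hd]
        exact graphProb_no_boundary_le hp0 hp1 A hAm
      · have : graphProb p (P3 A) = 0 := by
          simp only [graphProb, hP3, hAm, false_and, if_false]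
          exact graphExp_const 0
        rw [this]
        positivity
    have := graphProb_or_le hp0 hp1 (fun G => ∃ v ∈ univ, P1 v G)
      (fun G => ∃ A ∈ univ.filter Finset.Nonempty, P2 A G)
    linarith
  · refine (graphProb_exists_le hp0 hp1 _ _).trans
      ((sum_le_sum (g := fun _ => Real.exp (-(y / 2))) fun z _ => ?_).trans ?_)
    · refine (graphProb_star_sum_le hp0 hp1 z.1
        (overlapWeight j (4 * d) ((5 * d) ^ j) z.2) ((5 * d) ^ (j + 2)) y
        (overlapWeight_nonneg _ _ hM0 _) (overlapWeight_le_one _ (by positivity) hM0 (h5j j) _)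
        fun H => (sum_overlapWeight_le _ (by positivity) hM0 (h5j j) _ H).trans (h5j _)).trans ?_
      refine Real.exp_le_exp.2 ?_
      linarith
    · rw [sum_const, card_univ, nsmul_eq_mul, Fintype.card_prod, Nat.cast_mul, pow_two]

/-- The seed list `l` serves the graph `G` well: the scans make few queries, and the seeds hit by a
vertex `v` are not all close to a vertex that is not adjacent to `v`. -/
def IsGoodSeedList (G : SimpleGraph V) (k t : ℕ) (c : ℝ) (l : List V) : Prop :=
  ∑ v, (stopTime (fun s => s ∈ closedBall G k v) l t : ℝ) ≤ c ∧
    ∀ u v, u ≠ v → ¬ G.Adj v u →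
      ¬ FirstHitsIn (fun s => s ∈ closedBall G k v) (fun s => s ∈ closedBall G (k + 1) u) l t

/-- A random seed list serves a typical graph well. The number `m` of seeds is irrelevant here; it
matters in `isReconstructibleBy_of_isGoodSeedList`. -/
lemma seedExp_not_isGoodSeedList_le [Nonempty V] {G : SimpleGraph V} {k : ℕ} {d a b ρ : ℝ}
    (hG : IsTypical G k d a b ρ) (ha : 0 < a) (hb : 0 < b) (hρ : 0 ≤ ρ) (t m : ℕ) :
    seedExp m (fun l => if ¬ IsGoodSeedList G k t (4 * t * Fintype.card V ^ 2 / a) l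
        then 1 else 0) ≤
      Real.exp (-(t * Fintype.card V / b)) + Fintype.card V ^ 2 * ρ ^ t := by
  have hn : (0 : ℝ) < Fintype.card V := by exact_mod_cast Fintype.card_pos
  set n : ℝ := (Fintype.card V : ℝ) with hn'
  set T : List V → ℝ := fun l => ∑ v, (stopTime (fun s => s ∈ closedBall G k v) l t : ℝ) with hT
  set P : V × V → List V → Prop := fun z l => z.2 ≠ z.1 ∧ ¬ G.Adj z.1 z.2 ∧
    FirstHitsIn (fun s => s ∈ closedBall G k z.1) (fun s => s ∈ closedBall G (k + 1) z.2) l t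
    with hP
  have h1 : ∀ l : List V, (if ¬ IsGoodSeedList G k t (4 * t * n ^ 2 / a) l then (1 : ℝ) else 0) ≤
      Real.exp (-(2 * t * n / b)) * Real.exp (a / (2 * b * n) * T l) +
        ∑ z, if P z l then 1 else 0 := by
    intro l
    have hnn : ∀ z ∈ (univ : Finset (V × V)), (0 : ℝ) ≤ if P z l then 1 else 0 :=
      fun z _ => by split_ifs <;> norm_num
    by_cases h : IsGoodSeedList G k t (4 * t * n ^ 2 / a) l
    swap
    · rw [if_pos h]
      by_cases hTl : T l ≤ 4 * t * n ^ 2 / a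
      · have : ∃ z, P z l := by
          by_contra hno
          refine h ⟨hTl, fun u v huv hadj hF => hno ⟨(v, u), huv, hadj, hF⟩⟩
        obtain ⟨z, hz⟩ := this
        have h2 := single_le_sum hnn (mem_univ z)
        rw [if_pos hz] at h2
        have : 0 ≤ Real.exp (-(2 * t * n / b)) * Real.exp (a / (2 * b * n) * T l) := by positivity
        linarith
      · have h2 : 1 ≤ Real.exp (-(2 * t * n / b)) * Real.exp (a / (2 * b * n) * T l) := by
          rw [← Real.exp_add]
          refine Real.one_le_exp ?_
          have h3 : a / (2 * b * n) * (4 * t * n ^ 2 / a) = 2 * t * n / b := by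
            field_simp
            ring
          have h4 : a / (2 * b * n) * (4 * t * n ^ 2 / a) ≤ a / (2 * b * n) * T l :=
            mul_le_mul_of_nonneg_left (le_of_not_ge hTl) (by positivity)
          linarith
        have := sum_nonneg hnn
        linarith
    · rw [if_neg (not_not.2 h)]
      exact add_nonneg (by positivity) (sum_nonneg hnn)
  refine (seedExp_mono fun l _ => h1 l).trans ?_
  rw [seedExp_add, seedExp_const_mul, seedExp_sum]
  refine add_le_add ?_ ?_
  · have h2 := seedExp_exp_sum_stopTime_le (fun v s => s ∈ closedBall G k v) (a := a) hb
      (fun v => by simpa using hG.le_card_closedBall v)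
      (fun s => le_trans (Nat.cast_le.2 (card_le_card fun v hv =>
        mem_closedBall_comm.1 (by simpa using hv))) (hG.card_closedBall_le s)) m (fun _ => t)
    refine (mul_le_mul_of_nonneg_left h2 (Real.exp_pos _).le).trans ?_
    rw [← Real.exp_add, sum_const, card_univ, nsmul_eq_mul, ← hn']
    refine Real.exp_le_exp.2 (le_of_eq ?_)
    ring
  · refine (sum_le_sum (g := fun _ => ρ ^ t) fun z _ => ?_).trans ?_
    · by_cases hz : z.2 ≠ z.1 ∧ ¬ G.Adj z.1 z.2
      · refine le_trans (seedExp_mono (g := fun l => if FirstHitsIn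
          (fun s => s ∈ closedBall G k z.1) (fun s => s ∈ closedBall G (k + 1) z.2) l t
          then 1 else 0) fun l _ => ?_) (seedExp_firstHitsIn_le _ _ hρ ?_ m t)
        · simp only [hP, hz, true_and, not_false_eq_true, ne_eq]
          exact le_rfl
        · refine le_trans (Nat.cast_le.2 (card_le_card fun s hs => ?_))
            ((hG.card_inter_le _ _ hz.1 hz.2).trans (mul_le_mul_of_nonneg_left
              ((hG.le_card_closedBall z.1).trans (Nat.cast_le.2 (card_le_card fun s hs => ?_))) hρ))
          · simpa using hs
          · simpa using hs
      · have : ∀ l, ¬ P z l := fun l h => hz ⟨h.1, h.2.1⟩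
        simp only [this, if_false, seedExp_const]
        positivity
    · rw [sum_const, card_univ, nsmul_eq_mul, Fintype.card_prod, Nat.cast_mul, pow_two]

/-- If the list is longer than the bound `c` on the total time of the scans, then no scan exhausts
it, so that each vertex is hit `t` times and all the pairs left unresolved are edges. -/
lemma isReconstructibleBy_of_isGoodSeedList {G : SimpleGraph V} {k t q : ℕ} {d a b ρ c : ℝ}
    (hG : IsTypical G k d a b ρ) {l : List V} (hl : IsGoodSeedList G k t c l) (hc : c < l.length)
    (hq : c + 4 * d * Fintype.card V ≤ q) :
    IsReconstructibleBy (seedAlgorithm k l t) q G := by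
  refine isReconstructibleBy_seedAlgorithm hG.connected ?_
  have htime : ∀ v, stopTime (fun s => s ∈ closedBall G k v) l t < l.length := by
    intro v
    have h1 := single_le_sum (f := fun v => (stopTime (fun s => s ∈ closedBall G k v) l t : ℝ))
      (fun i _ => Nat.cast_nonneg _) (mem_univ v)
    have h2 := lt_of_le_of_lt (h1.trans hl.1) hc
    exact_mod_cast h2
  have hsub : ({z : V × V | z.1 ≠ z.2 ∧ ¬ Resolved (scanResult G k l t) z.1 z.2} :
      Finset (V × V)) ⊆ (univ.sigma (fun v => ({x | G.Adj v x} : Finset V))).map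
        (Equiv.sigmaEquivProd V V).toEmbedding := by
    rintro ⟨u, v⟩ hz
    simp only [mem_filter, mem_univ, true_and] at hz
    simp only [mem_map_equiv, mem_sigma, mem_univ, true_and, mem_filter]
    by_contra hadj
    have hadj' : ¬ G.Adj u v := hadj
    exact hz.2 (resolved_of_not_firstHitsIn (htime u) (htime v) (hl.2 v u hz.1.symm hadj')
      (hl.2 u v hz.1 fun h => hadj' h.symm))
  have h3 := card_le_card hsub
  rw [card_map, card_sigma] at h3
  have h4 : (∑ v, #{x | G.Adj v x} : ℝ) ≤ 4 * d * Fintype.card V := by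
    refine (sum_le_sum fun v _ => hG.degree_le v).trans ?_
    rw [sum_const, card_univ, nsmul_eq_mul, mul_comm]
  have h5 : ((∑ v, stopTime (fun s => s ∈ closedBall G k v) l t +
      #{z : V × V | z.1 ≠ z.2 ∧ ¬ Resolved (scanResult G k l t) z.1 z.2} : ℕ) : ℝ) ≤ q := by
    have h6 : (#{z : V × V | z.1 ≠ z.2 ∧ ¬ Resolved (scanResult G k l t) z.1 z.2} : ℝ) ≤
      ∑ v, #{x | G.Adj v x} := by exact_mod_cast h3
    have h7 := hl.1
    push_cast at h6 ⊢
    linarith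
  exact_mod_cast h5

/-- A version of the theorem for a fixed vertex set, with an explicit bound on the probability of
failure. -/
lemma exists_graphProb_not_isReconstructibleBy_le [Nonempty V] {p d y ρ : ℝ} (hp0 : 0 ≤ p)
    (hp1 : p ≤ 1) (j : ℕ) (hd : d = Fintype.card V * p) (hd1 : 1 ≤ d) (hM1 : (5 * d) ^ j * p ≤ 1)
    (hM2 : 2 * (5 * d) ^ j ≤ Fintype.card V) (hy : 4 * p * (5 * d) ^ (j + 2) ≤ y) (hρ0 : 0 ≤ ρ)
    (hρ : (5 * d) ^ j * (1 + y) ≤ ρ * (d / 16) ^ (j + 1)) (t q : ℕ)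
    (hq : 4 * t * Fintype.card V ^ 2 / (d / 16) ^ (j + 1) + 4 * d * Fintype.card V ≤ q) :
    ∃ A : QueryAlgorithm V,
      graphProb p (fun G : SimpleGraph V => ¬ IsReconstructibleBy A q G) ≤
        Fintype.card V * Real.exp (-(2 * d)) +
          2 * (Real.exp (Fintype.card V * Real.exp (-(d / 16))) - 1) +
          Fintype.card V ^ 2 * Real.exp (-(y / 2)) +
          (Real.exp (-(t * Fintype.card V / (5 * d) ^ (j + 1))) + Fintype.card V ^ 2 * ρ ^ t) := by
  set a := (d / 16) ^ (j + 1) with ha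
  set b := (5 * d) ^ (j + 1) with hb
  have ha0 : 0 < a := by positivity
  have hb0 : 0 < b := by positivity
  set c : ℝ := 4 * t * Fintype.card V ^ 2 / a with hc
  -- The list of seeds has to be longer than the total time allowed for the scans.
  obtain ⟨m, hm⟩ := exists_nat_gt c
  set F : SimpleGraph V → List V → ℝ := fun G l =>
    if IsTypical G (j + 1) d a b ρ then (if ¬ IsGoodSeedList G (j + 1) t c l then 1 else 0)
      else 0 with hF
  set δ := Real.exp (-(t * Fintype.card V / b)) + Fintype.card V ^ 2 * ρ ^ t with hδ
  have hδ0 : 0 ≤ δ := by positivity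
  have h1 : graphExp p (fun G => seedExp m (F G)) ≤ δ := by
    refine (graphExp_mono hp0 hp1 (g := fun _ => δ) fun G => ?_).trans (graphExp_const δ).le
    by_cases hG : IsTypical G (j + 1) d a b ρ
    · simp only [hF, if_pos hG]
      exact seedExp_not_isGoodSeedList_le hG ha0 hb0 hρ0 t m
    · simp only [hF, if_neg hG, seedExp_const]
      exact hδ0
  obtain ⟨l, hl, hlF⟩ := exists_graphExp_le_of_seedExp_le m F h1
  refine ⟨seedAlgorithm (j + 1) l t, le_trans ?_
    (add_le_add (graphProb_not_isTypical_le hp0 hp1 j hd hd1 hM1 hM2 hy hρ) hlF)⟩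
  rw [graphProb, graphProb, ← graphExp_add]
  refine graphExp_mono hp0 hp1 fun G => ?_
  have h01 : ∀ P : Prop, (0 : ℝ) ≤ (if P then 1 else 0) ∧ (if P then (1 : ℝ) else 0) ≤ 1 := by
    intro P
    split_ifs <;> norm_num
  have hF0 : 0 ≤ F G l := by
    simp only [hF]
    split_ifs <;> norm_num
  by_cases hG : IsTypical G (j + 1) d a b ρ
  · by_cases hgood : IsGoodSeedList G (j + 1) t c l
    · have := isReconstructibleBy_of_isGoodSeedList hG hgood (by rwa [hl]) hq
      rw [if_neg (not_not.2 this)]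
      exact add_nonneg (h01 _).1 hF0
    · have hF1 : F G l = 1 := by
        simp only [hF]
        rw [if_pos hG, if_pos hgood]
      rw [hF1]
      exact (h01 _).2.trans (le_add_of_nonneg_left (h01 _).1)
  · refine (h01 _).2.trans (le_trans (le_of_eq ?_) (le_add_of_nonneg_right hF0))
    rw [if_pos hG]

end Typical

/-! ### Asymptotics -/

section Asymptotics

open Filter Topology

lemma tendsto_rpow_mul_exp_neg_rpow (a : ℝ) {b c : ℝ} (hb : 0 < b) (hc : 0 < c) :
    Tendsto (fun x : ℝ => x ^ a * Real.exp (-(c * x ^ b))) atTop (𝓝 0) := by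
  have h := (tendsto_rpow_mul_exp_neg_mul_atTop_nhds_zero (a / b) c hc).comp
    (tendsto_rpow_atTop hb)
  refine h.congr' ?_
  filter_upwards [eventually_ge_atTop 0] with x hx
  simp only [Function.comp]
  rw [← Real.rpow_mul hx, mul_div_cancel₀ _ hb.ne', neg_mul]

/-- The bound on the probability of failure for random graphs with `x` vertices. -/
noncomputable def failureBound (ε x : ℝ) : ℝ :=
  x ^ (1 : ℝ) * Real.exp (-(1 / 16 * x ^ ε)) +
    2 * (Real.exp (x ^ (1 : ℝ) * Real.exp (-(1 / 16 * x ^ ε))) - 1) +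
    x ^ (2 : ℝ) * Real.exp (-(1 / 2 * x ^ (ε / 2))) +
    (x ^ (0 : ℝ) * Real.exp (-(1 * x ^ (ε / 4))) + x ^ (-1 : ℝ))

lemma tendsto_failureBound {ε : ℝ} (hε : 0 < ε) :
    Tendsto (failureBound ε) atTop (𝓝 0) := by
  have h1 := tendsto_rpow_mul_exp_neg_rpow 1 hε (c := 1 / 16) (by norm_num)
  have h2 := ((Real.continuous_exp.tendsto 0).comp h1).sub_const 1 |>.const_mul 2
  have h3 := tendsto_rpow_mul_exp_neg_rpow 2 (b := ε / 2) (c := 1 / 2) (by positivity) (by norm_num)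
  have h4 := tendsto_rpow_mul_exp_neg_rpow 0 (b := ε / 4) (c := 1) (by positivity) (by norm_num)
  have h5 := tendsto_rpow_neg_atTop (y := 1) one_pos
  have h := ((h1.add h2).add h3).add (h4.add h5)
  simp only [Real.exp_zero, sub_self, mul_zero, add_zero] at h
  exact h

/-- The choice of the threshold `y = d / s ^ 2` and of the fraction `ρ = 1 / s` satisfies all the
conditions of the finite version of the theorem, where `s` is a small power of the number `x` of
vertices. -/
lemma threshold_conditions {j : ℕ} {x p s d : ℝ} (hs : 4 * 5 ^ (j + 2) * 16 ^ (j + 1) ≤ s)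
    (hd : d = x * p) (hsd : s ^ 4 ≤ d) (hdx : d ^ (j + 2) * s ^ 8 ≤ x) :
    1 ≤ d ∧ (5 * d) ^ j * p ≤ 1 ∧ 2 * (5 * d) ^ j ≤ x ∧
      4 * p * (5 * d) ^ (j + 2) ≤ d / s ^ 2 ∧
      (5 * d) ^ j * (1 + d / s ^ 2) ≤ 1 / s * (d / 16) ^ (j + 1) ∧
      d ^ (j + 2) ≤ x ∧ s ≤ x / (5 * d) ^ (j + 1) := by
  have h16 : (1 : ℝ) ≤ 16 ^ (j + 1) := one_le_pow₀ (by norm_num)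
  have h5 : (1 : ℝ) ≤ 5 ^ j := one_le_pow₀ (by norm_num)
  have hc1 : 4 * (5 : ℝ) ^ (j + 2) ≤ s := by
    nlinarith [pow_pos (show (0 : ℝ) < 5 by norm_num) (j + 2)]
  have hc2 : 100 * (5 : ℝ) ^ j ≤ s := by rw [pow_add] at hc1; linarith
  have hs1 : 1 ≤ s := by linarith
  have hs0 : 0 < s := by linarith
  have hd1 : 1 ≤ d := (one_le_pow₀ hs1).trans hsd
  have hd0 : 0 < d := by linarith
  have hs8 : s ≤ s ^ 8 := le_self_pow₀ hs1 (by norm_num)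
  have hds : d ^ (j + 2) * s ≤ x := (mul_le_mul_of_nonneg_left hs8 (by positivity)).trans hdx
  have hdj1 : d ^ (j + 1) ≤ d ^ (j + 2) := pow_le_pow_right₀ hd1 (by lia)
  have hdj : d ^ j ≤ d ^ (j + 2) := pow_le_pow_right₀ hd1 (by lia)
  have hx0 : 0 < x := lt_of_lt_of_le (by positivity) hdx
  have hp : p = d / x := by rw [hd]; field_simp
  refine ⟨hd1, ?_, ?_, ?_, ?_, ?_, ?_⟩
  · rw [hp, mul_div_assoc', div_le_one hx0, mul_pow, mul_assoc, ← pow_succ]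
    calc (5 : ℝ) ^ j * d ^ (j + 1) ≤ s * d ^ (j + 2) := by
          gcongr
          linarith
      _ ≤ x := by linarith
  · calc 2 * (5 * d) ^ j = (2 * 5 ^ j) * d ^ j := by rw [mul_pow]; ring
      _ ≤ s * d ^ (j + 2) := by
          gcongr
          linarith
      _ ≤ x := by linarith
  · rw [hp, le_div_iff₀ (by positivity)]
    have h1 : (4 * 5 ^ (j + 2)) * s ^ 2 * d ^ (j + 2) ≤ x := by
      calc (4 * 5 ^ (j + 2)) * s ^ 2 * d ^ (j + 2) ≤ s * s ^ 2 * d ^ (j + 2) := by gcongr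
        _ = d ^ (j + 2) * s ^ 3 := by ring
        _ ≤ d ^ (j + 2) * s ^ 8 := by gcongr; norm_num
        _ ≤ x := hdx
    calc 4 * (d / x) * (5 * d) ^ (j + 2) * s ^ 2
        = d * ((4 * 5 ^ (j + 2)) * s ^ 2 * d ^ (j + 2)) / x := by rw [mul_pow]; ring
      _ ≤ d * x / x := by gcongr
      _ = d := by field_simp
  · have h1 : 1 ≤ d / s ^ 2 := by
      rw [le_div_iff₀ (by positivity), one_mul]
      exact (pow_le_pow_right₀ hs1 (by norm_num)).trans hsd
    have h2 : 2 * 5 ^ j * 16 ^ (j + 1) ≤ s := by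
      refine le_trans ?_ hs
      rw [pow_add 5 j 2]
      nlinarith
    calc (5 * d) ^ j * (1 + d / s ^ 2) ≤ (5 * d) ^ j * (2 * (d / s ^ 2)) := by gcongr; linarith
      _ = (2 * 5 ^ j * 16 ^ (j + 1)) * (d ^ (j + 1) / (s ^ 2 * 16 ^ (j + 1))) := by
          rw [mul_pow]; field_simp; ring
      _ ≤ s * (d ^ (j + 1) / (s ^ 2 * 16 ^ (j + 1))) := by gcongr
      _ = _ := by rw [div_pow]; field_simp
  · nlinarith [pow_pos hd0 (j + 2)]
  · rw [le_div_iff₀ (by positivity), mul_pow]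
    have h1 : (5 : ℝ) ^ (j + 1) ≤ s := by rw [pow_succ]; linarith
    calc s * (5 ^ (j + 1) * d ^ (j + 1)) ≤ s * (s * d ^ (j + 2)) := by gcongr
      _ = d ^ (j + 2) * s ^ 2 := by ring
      _ ≤ d ^ (j + 2) * s ^ 8 := by gcongr; norm_num
      _ ≤ x := hdx

lemma degree_bounds {j : ℕ} {x p ε : ℝ} (hx : 1 ≤ x) (hp : x ^ (-1 + ε) < p)
    (hp' : p < x ^ (-(((j + 1 : ℕ) : ℝ) / (((j + 1 : ℕ) : ℝ) + 1)) - ε)) (hε : 0 < ε) :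
    (x ^ (ε / 4)) ^ 4 ≤ x * p ∧ (x * p) ^ (j + 2) * (x ^ (ε / 4)) ^ 8 ≤ x := by
  have hx0 : 0 < x := by linarith
  have hp0 : 0 < p := (Real.rpow_pos_of_pos hx0 _).trans hp
  constructor
  · calc (x ^ (ε / 4)) ^ 4 = x ^ (1 + (-1 + ε)) := by
          rw [← Real.rpow_natCast, ← Real.rpow_mul hx0.le]; congr 1; push_cast; ring
      _ = x * x ^ (-1 + ε) := by rw [Real.rpow_add hx0, Real.rpow_one]
      _ ≤ x * p := by gcongr
  · have h1 : x * p ≤ x ^ (1 / ((j : ℝ) + 2) - ε) := by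
      calc x * p ≤ x * x ^ (-(((j + 1 : ℕ) : ℝ) / (((j + 1 : ℕ) : ℝ) + 1)) - ε) := by gcongr
        _ = x ^ (1 + (-(((j + 1 : ℕ) : ℝ) / (((j + 1 : ℕ) : ℝ) + 1)) - ε)) := by
            rw [Real.rpow_add hx0, Real.rpow_one]
        _ = _ := by
            congr 1
            push_cast
            have : (j : ℝ) + 1 + 1 ≠ 0 := by positivity
            have : (j : ℝ) + 2 ≠ 0 := by positivity
            field_simp
            ring
    calc (x * p) ^ (j + 2) * (x ^ (ε / 4)) ^ 8
        ≤ (x ^ (1 / ((j : ℝ) + 2) - ε)) ^ (j + 2) * (x ^ (ε / 4)) ^ 8 := by gcongr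
      _ = x ^ ((1 / ((j : ℝ) + 2) - ε) * ((j : ℝ) + 2) + ε / 4 * 8) := by
          rw [Real.rpow_add hx0, ← Real.rpow_natCast, ← Real.rpow_natCast, ← Real.rpow_mul hx0.le,
            ← Real.rpow_mul hx0.le]
          push_cast
          rfl
      _ ≤ x ^ (1 : ℝ) := by
          refine Real.rpow_le_rpow_of_exponent_le hx ?_
          have h2 : (1 / ((j : ℝ) + 2) - ε) * ((j : ℝ) + 2) = 1 - ε * (j + 2) := by
            have : (j : ℝ) + 2 ≠ 0 := by positivity
            field_simp
          rw [h2]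
          nlinarith [mul_nonneg hε.le (Nat.cast_nonneg (α := ℝ) j)]
      _ = x := Real.rpow_one x

lemma exists_graphProb_not_isReconstructibleBy_le_failureBound (j : ℕ) {ε : ℝ} (hε : 0 < ε) :
    ∃ C : ℝ, 0 < C ∧ ∀ᶠ n : ℕ in atTop, ∀ p : ℝ, 0 ≤ p → p ≤ 1 → (n : ℝ) ^ (-1 + ε) < p →
      p < (n : ℝ) ^ (-(((j + 1 : ℕ) : ℝ) / (((j + 1 : ℕ) : ℝ) + 1)) - ε) →
      ∃ A : QueryAlgorithm (Fin n),
        graphProb p (fun G : SimpleGraph (Fin n) => ¬ IsReconstructibleBy A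
          ⌊C / ((n : ℝ) ^ (((j + 1 : ℕ) : ℤ) - 2) * p ^ (j + 1))⌋₊ G) ≤ failureBound ε n := by
  -- With `ρ = n ^ (-ε / 4)`, this makes `n ^ 2 * ρ ^ t` at most `1 / n`.
  set t : ℕ := ⌈12 / ε⌉₊ with ht
  have htε : 12 ≤ ε * t := by
    have := Nat.le_ceil (12 / ε)
    rw [div_le_iff₀ hε] at this
    linarith
  have ht1 : (1 : ℝ) ≤ t := by
    have : 0 < t := Nat.ceil_pos.2 (by positivity)
    exact_mod_cast this
  refine ⟨4 * t * 16 ^ (j + 1) + 5, by positivity, ?_⟩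
  have hlarge := ((tendsto_rpow_atTop (show 0 < ε / 4 by positivity)).comp
    tendsto_natCast_atTop_atTop).eventually_ge_atTop (4 * 5 ^ (j + 2) * 16 ^ (j + 1) : ℝ)
  filter_upwards [hlarge, eventually_ge_atTop 1] with n hs hn p hp0 hp1 hp hp'
  simp only [Function.comp] at hs
  have : Nonempty (Fin n) := ⟨⟨0, hn⟩⟩
  set x : ℝ := (n : ℝ) with hx
  have hx1 : 1 ≤ x := by rw [hx]; exact_mod_cast hn
  have hx0 : 0 < x := by linarith
  set s : ℝ := x ^ (ε / 4) with hsdef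
  obtain ⟨hsd, hdx⟩ := degree_bounds hx1 hp hp' hε
  set d : ℝ := x * p with hd
  obtain ⟨h1, h2, h3, h4, h5, h6, h7⟩ := threshold_conditions hs hd hsd hdx
  have hs0 : 0 < s := Real.rpow_pos_of_pos hx0 _
  have hd0 : 0 < d := by linarith
  have hpp : 0 < p := (Real.rpow_pos_of_pos hx0 _).trans hp
  have hcard : (Fintype.card (Fin n) : ℝ) = x := by rw [Fintype.card_fin]
  have hden : (4 * t * 16 ^ (j + 1) + 5) / (x ^ (((j + 1 : ℕ) : ℤ) - 2) * p ^ (j + 1)) =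
      (4 * t * 16 ^ (j + 1) + 5) * (x ^ 2 / d ^ (j + 1)) := by
    rw [zpow_sub₀ hx0.ne', zpow_natCast, hd, mul_pow]
    norm_cast
    field_simp
  -- Of the constant, `4 * t * 16 ^ (j + 1)` pays for the scans, `4` for the edges, and `1` for the
  -- floor.
  obtain ⟨A, hA⟩ := exists_graphProb_not_isReconstructibleBy_le (V := Fin n) hp0 hp1 j
    (d := d) (y := d / s ^ 2) (ρ := 1 / s) (by rw [hcard]) h1 h2 (by rw [hcard]; exact h3) h4
    (by positivity) h5 t
    ⌊(4 * t * 16 ^ (j + 1) + 5) / (x ^ (((j + 1 : ℕ) : ℤ) - 2) * p ^ (j + 1))⌋₊ (by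
      refine le_trans ?_ (Nat.sub_one_lt_floor _).le
      rw [hden, hcard]
      have h8 : x * d ≤ x ^ 2 / d ^ (j + 1) := by
        rw [le_div_iff₀ (by positivity)]
        calc x * d * d ^ (j + 1) = x * d ^ (j + 2) := by ring
          _ ≤ x * x := by gcongr
          _ = x ^ 2 := by ring
      have h9 : 1 ≤ x * d := by nlinarith
      have h10 : 4 * t * x ^ 2 / (d / 16) ^ (j + 1) =
          4 * t * 16 ^ (j + 1) * (x ^ 2 / d ^ (j + 1)) := by
        rw [div_pow]; field_simp
      rw [h10]
      linarith)
  refine ⟨A, hA.trans ?_⟩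
  rw [hcard, failureBound, Real.rpow_one, Real.rpow_zero, Real.rpow_two]
  have hs4 : x ^ ε = s ^ 4 := by
    rw [hsdef, ← Real.rpow_natCast, ← Real.rpow_mul hx0.le]; congr 1; push_cast; ring
  have hs2 : x ^ (ε / 2) = s ^ 2 := by
    rw [hsdef, ← Real.rpow_natCast, ← Real.rpow_mul hx0.le]; congr 1; push_cast; ring
  have hys : s ^ 2 ≤ d / s ^ 2 := by
    rw [le_div_iff₀ (by positivity)]
    linarith [show s ^ 2 * s ^ 2 = s ^ 4 by ring]
  have hρ : x ^ 2 * (1 / s) ^ t ≤ x ^ (-1 : ℝ) := by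
    rw [one_div, hsdef, ← Real.rpow_neg hx0.le, ← Real.rpow_natCast (x ^ (-(ε / 4))),
      ← Real.rpow_mul hx0.le, ← Real.rpow_two, ← Real.rpow_add hx0]
    refine Real.rpow_le_rpow_of_exponent_le hx1 ?_
    linarith
  rw [hs4, hs2]
  gcongr
  · linarith
  · linarith
  · linarith
  · rw [one_mul, one_mul]
    refine Real.exp_le_exp.2 (neg_le_neg ?_)
    rw [mul_div_assoc]
    nlinarith

end Asymptotics

end DistanceReconstruction

theorem theorem1 (k : ℕ) (hk : 1 ≤ k) (ε : ℝ) (hε : 0 < ε) :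
    ∃ C : ℝ, 0 < C ∧
      ∀ p : ℕ → unitInterval,
        (∀ᶠ n : ℕ in Filter.atTop,
          (n : ℝ) ^ (-1 + ε) < (p n : ℝ) ∧
            (p n : ℝ) < (n : ℝ) ^ (-((k : ℝ) / ((k : ℝ) + 1)) - ε)) →
        ∃ A : (n : ℕ) → QueryAlgorithm (Fin n),
          Filter.Tendsto
            (fun n : ℕ => SimpleGraph.binomialRandom (Fin n) (p n)
              {G : SimpleGraph (Fin n) |
                IsReconstructibleBy (A n)
                  ⌊C / ((n : ℝ) ^ ((k : ℤ) - 2) * (p n : ℝ) ^ k)⌋₊ G})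
            Filter.atTop (nhds 1) := by
  open DistanceReconstruction in
  obtain ⟨j, rfl⟩ : ∃ j, k = j + 1 := ⟨k - 1, by lia⟩
  obtain ⟨C, hC, hev⟩ := exists_graphProb_not_isReconstructibleBy_le_failureBound j hε
  refine ⟨C, hC, fun p hp => ?_⟩
  have hA : ∀ n : ℕ, ∃ A : QueryAlgorithm (Fin n),
      (∃ A : QueryAlgorithm (Fin n), graphProb (p n : ℝ) (fun G => ¬ IsReconstructibleBy A
          ⌊C / ((n : ℝ) ^ (((j + 1 : ℕ) : ℤ) - 2) * (p n : ℝ) ^ (j + 1))⌋₊ G) ≤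
            failureBound ε n) →
        graphProb (p n : ℝ) (fun G => ¬ IsReconstructibleBy A
          ⌊C / ((n : ℝ) ^ (((j + 1 : ℕ) : ℤ) - 2) * (p n : ℝ) ^ (j + 1))⌋₊ G) ≤
            failureBound ε n := by
    intro n
    by_cases h : ∃ A : QueryAlgorithm (Fin n), graphProb (p n : ℝ) (fun G =>
      ¬ IsReconstructibleBy A
        ⌊C / ((n : ℝ) ^ (((j + 1 : ℕ) : ℤ) - 2) * (p n : ℝ) ^ (j + 1))⌋₊ G) ≤ failureBound ε n
    · obtain ⟨A, hA⟩ := h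
      exact ⟨A, fun _ => hA⟩
    · exact ⟨.halt, fun h' => absurd h' h⟩
  choose A hA using hA
  refine ⟨A, ?_⟩
  have hlow : Filter.Tendsto (fun n : ℕ => ENNReal.ofReal (1 - failureBound ε n)) Filter.atTop
      (nhds 1) := by
    have h1 : Filter.Tendsto (fun n : ℕ => 1 - failureBound ε n) Filter.atTop (nhds (1 - 0)) :=
      ((tendsto_failureBound hε).comp tendsto_natCast_atTop_atTop).const_sub 1
    simpa using ENNReal.tendsto_ofReal h1
  refine tendsto_of_tendsto_of_tendsto_of_le_of_le' hlow tendsto_const_nhds ?_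
    (Filter.Eventually.of_forall fun n => MeasureTheory.prob_le_one)
  filter_upwards [hev, hp] with n hn hpn
  have h1 := hA n (hn (p n) (p n).2.1 (p n).2.2 hpn.1 hpn.2)
  rw [binomialRandom_eq_ofReal_graphProb]
  refine ENNReal.ofReal_le_ofReal ?_
  have h2 := graphProb_or_le (p n).2.1 (p n).2.2
    (fun G => IsReconstructibleBy (A n)
      ⌊C / ((n : ℝ) ^ (((j + 1 : ℕ) : ℤ) - 2) * (p n : ℝ) ^ (j + 1))⌋₊ G)
    (fun G => ¬ IsReconstructibleBy (A n)
      ⌊C / ((n : ℝ) ^ (((j + 1 : ℕ) : ℤ) - 2) * (p n : ℝ) ^ (j + 1))⌋₊ G)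
  have h3 : graphProb (p n : ℝ) (fun G : SimpleGraph (Fin n) => IsReconstructibleBy (A n)
      ⌊C / ((n : ℝ) ^ (((j + 1 : ℕ) : ℤ) - 2) * (p n : ℝ) ^ (j + 1))⌋₊ G ∨
      ¬ IsReconstructibleBy (A n)
      ⌊C / ((n : ℝ) ^ (((j + 1 : ℕ) : ℤ) - 2) * (p n : ℝ) ^ (j + 1))⌋₊ G) = 1 := by
    simp only [graphProb, em, if_true]
    exact graphExp_const 1
  linarith
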